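/- Let $G$ and $H$ be arbitrary groups and let $A$ be a finite subset of the free product $\Gamma = G * H$. Then at least one of the following holds: 1. $A$ is conjugate into one of the factors, that is, there is $\gamma \in \Gamma$ such that $\gamma A \gamma^{-1} \subseteq G$ or $\gamma A \gamma^{-1} \subseteq H$ (with $G$ and $H$ regarded as subgroups of $\Gamma$ in the usual way); 2. $|A^3| \ge \frac{1}{7776}\,|A|^2$, where $A^3 = \{abc : a, b, c \in A\}$; 3. the subgroup $\langle A \rangle$ of $\Gamma$ generated by $A$ is infinite cyclic or infinite dihedral. -/

import Mathlib

open scoped Pointwise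

/-- `A` is conjugate into the subgroup `K`: some conjugate `γ A γ⁻¹` is contained in `K`. -/
def IsConjugateInto {Γ : Type*} [Group Γ] (A : Set Γ) (K : Subgroup Γ) : Prop :=
  ∃ γ : Γ, (fun a => γ * a * γ⁻¹) '' A ⊆ (K : Set Γ)

/-- `Γ` is an infinite cyclic group. -/
def IsInfiniteCyclic (Γ : Type*) [Group Γ] : Prop :=
  IsCyclic Γ ∧ Infinite Γ

/-- `Γ` is isomorphic to the infinite dihedral group, which is `DihedralGroup 0` in Mathlib
(rotations `r i` and reflections `sr i` for `i` in `ZMod 0 = ℤ`). -/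
def IsInfiniteDihedral (Γ : Type*) [Group Γ] : Prop :=
  Nonempty (Γ ≃* DihedralGroup 0)

/-!
The free product `Γ = G * H` acts on its Bass–Serre tree, whose vertices are the cosets of `G` and
of `H`. Only the identity fixes two vertices, and the stabilisers of the vertices are the conjugates
of the factors (`BassSerre.treeAction`, `BassSerre.isConjugateInto_of_smul_eq`). A set `A` with few
triple products is shown to fix a vertex of the tree or to stabilise a line on which some element
`t` acts as a translation (`TreeAction.exists_fixed_or_exists_axisStab`). The stabiliser of such a
line acts faithfully on it, so that its subgroups with more than two elements are infinite cyclic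
or infinite dihedral (`TreeAction.Hyp.isInfiniteCyclic_or_isInfiniteDihedral`).

Let the base point `o` minimise the total displacement `∑ d(o, a o)` of `A`. If many elements of `A`
fix `o`, then all of them do, because the products `s c s'` with `s`, `s'` fixing `o` and `c` moving
`o` are pairwise different. Otherwise look at the first edges of the geodesics from `o` to `a o`
and to `a⁻¹ o`. At most half of the elements of `A` have a given edge as both of these, since
moving `o` along this edge does not decrease the total displacement. Hence one finds
large parts `U` and `B` of `A` such that the products `u b u'` and `b u b'` are all reduced (their
lengths add up) and the elements of `B` are at least as long as those of `U`.

There are few products `u b u'`. An equality `u b v = u' b v'` between different reduced products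
means that `u⁻¹ u'` translates the geodesic from `o` to `b o` along itself. Two translations of a
geodesic commute if the sum of their lengths is less than that of the geodesic
(`TreeAction.IsShift.commute`), as the two products agree at two points. If `t` is the shortest
translation of the geodesic from `o` to `b o`, this forces most `u` to begin with long segments
translated by the conjugates of `t` at the two ends of `b` (`TreeAction.exists_period`). A collision
between products `b u b'` for such an element `u` therefore gives an element commuting with the
translations belonging to `b` and `b'`. Commutation is transitive among hyperbolic elements, because
their centralisers act faithfully by translations on their axes (`TreeAction.Hyp.commute`). It
follows that a large part of `B` lies in one coset of the stabiliser of an axis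
(`TreeAction.exists_axis_coset`), and since there are few triple products, all of `A` lies in this
stabiliser (`TreeAction.subset_axisStab`).
-/

/-! ### Actions on trees and translations of geodesics -/

/-- An isometric action of `Γ` on the vertex set `V` of a tree, given by the integer valued path
metric `d`. The tree axioms are the four point condition, the parity condition (which rules out
triangles) and the existence of a next vertex on the way from `x` to `y`. The action preserves
the bipartition of the tree, and only the identity fixes two different vertices. -/
structure TreeAction (Γ V : Type*) [Group Γ] [MulAction Γ V] where
  /-- The path metric of the tree. -/
  d : V → V → ℕ
  eq_of_d : ∀ {x y}, d x y = 0 → x = y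
  d_self : ∀ x, d x x = 0
  comm : ∀ x y, d x y = d y x
  four : ∀ w x y z, d w x + d y z ≤ d w y + d x z ∨ d w x + d y z ≤ d w z + d x y
  even : ∀ x y z, Even (d x y + d y z + d z x)
  step : ∀ {x y}, x ≠ y → ∃ z, d x z = 1 ∧ d z y + 1 = d x y
  smul : ∀ (g : Γ) (x y : V), d (g • x) (g • y) = d x y
  even_smul : ∀ (g : Γ) (x : V), Even (d x (g • x))
  free : ∀ (g : Γ) {x y : V}, g • x = x → g • y = y → x ≠ y → g = 1

namespace TreeAction

variable {Γ V : Type*} [Group Γ] [MulAction Γ V] (T : TreeAction Γ V)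

lemma tri (x y z : V) : T.d x z ≤ T.d x y + T.d y z := by
  have h := T.four x z y y
  have h1 := T.d_self y
  have h2 := T.comm z y
  omega

lemma d_inv_smul (g : Γ) (x y : V) : T.d (g⁻¹ • x) y = T.d x (g • y) := by
  rw [← T.smul g, smul_inv_smul]

/-- Two points of a geodesic are as far apart as their positions say. -/
lemma d_of_between {P Q x y : V} (hx : T.d P x + T.d x Q = T.d P Q)
    (hy : T.d P y + T.d y Q = T.d P Q) (h : T.d P x ≤ T.d P y) :
    T.d x y + T.d P x = T.d P y := by
  have h1 := T.four x y P Q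
  have h2 := T.tri P x y
  have h3 := T.comm x P
  have h4 := T.comm y P
  omega

lemma eq_of_between {P Q x y : V} (hx : T.d P x + T.d x Q = T.d P Q)
    (hy : T.d P y + T.d y Q = T.d P Q) (h : T.d P x = T.d P y) : x = y := by
  have := T.d_of_between hx hy h.le
  exact T.eq_of_d (by omega)

/-- `g` translates the geodesic from `p` to `q` by `σ` along itself: the points `p`, `g p`, `q`,
`g q` lie in this order on a geodesic, and `σ` is the distance of `p` to `g p` and of `q` to
`g q`. -/
structure IsShift (g : Γ) (p q : V) (σ : ℕ) : Prop where
  left : T.d p (g • p) = σ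
  mid : T.d (g • p) q + σ = T.d p q
  right : T.d q (g • q) = σ
  total : T.d p (g • q) = T.d p q + σ

variable {T}

/-- Four points in the right positions on a geodesic from `P` to `Q` form a translation. -/
lemma isShift_of_between {g : Γ} {p q P Q : V} {σ : ℕ}
    (hp : T.d P p + T.d p Q = T.d P Q) (hq : T.d P q + T.d q Q = T.d P Q)
    (hgp : T.d P (g • p) + T.d (g • p) Q = T.d P Q)
    (hgq : T.d P (g • q) + T.d (g • q) Q = T.d P Q)
    (h1 : T.d P (g • p) = T.d P p + σ) (h2 : T.d P (g • q) = T.d P q + σ)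
    (h3 : T.d P p + σ ≤ T.d P q) : T.IsShift g p q σ := by
  have a1 := T.d_of_between hp hgp (by omega)
  have a2 := T.d_of_between hgp hq (by omega)
  have a3 := T.d_of_between hq hgq (by omega)
  have a4 := T.d_of_between hp hgq (by omega)
  have a5 := T.d_of_between hp hq (by omega)
  constructor <;> omega

namespace IsShift

variable {g h k : Γ} {p q r : V} {σ τ : ℕ}

lemma inv (hg : T.IsShift g p q σ) : T.IsShift g⁻¹ q p σ := by
  obtain ⟨h1, h2, h3, h4⟩ := hg
  have e1 := T.comm q p
  constructor
  · rw [T.comm, T.d_inv_smul]; exact h3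
  · rw [T.d_inv_smul, T.comm, e1]; exact h2
  · rw [T.comm, T.d_inv_smul]; exact h1
  · rw [T.comm, T.d_inv_smul, e1]; exact h4

lemma conj (hg : T.IsShift g p q σ) (k : Γ) : T.IsShift (k * g * k⁻¹) (k • p) (k • q) σ := by
  obtain ⟨h1, h2, h3, h4⟩ := hg
  constructor <;> simpa [mul_smul, T.smul]

/-- The shift restricted to an initial segment. -/
lemma restrict_left (hg : T.IsShift g p q σ) (hr : T.d p r + T.d r q = T.d p q)
    (hσ : σ ≤ T.d p r) : T.IsShift g p r σ := by
  have e1 := hg.total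
  have e2 := hg.right
  have e3 := hg.left
  have s1 := T.smul g p r
  have s2 := T.smul g r q
  have s3 := T.smul g p q
  have t1 := T.tri p r (g • q)
  have t2 := T.tri r q (g • q)
  have t3 := T.tri p (g • r) (g • q)
  have t4 := T.tri p (g • p) (g • r)
  have z := T.d_self p
  refine isShift_of_between (P := p) (Q := g • q) ?_ ?_ ?_ ?_ ?_ ?_ ?_ <;> omega

/-- The shift restricted to a final segment. -/
lemma restrict_right (hg : T.IsShift g p q σ) (hr : T.d p r + T.d r q = T.d p q)
    (hσ : σ ≤ T.d r q) : T.IsShift g r q σ := by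
  have e1 := T.comm p r
  have e2 := T.comm r q
  have e3 := T.comm p q
  have := (hg.inv.restrict_left (r := r) (by omega) (by omega)).inv
  simpa using this

lemma apply_apply (hg : T.IsShift g p q σ) (hh : T.IsShift h p q τ) (hστ : σ + τ ≤ T.d p q) :
    T.d p (g • h • p) = σ + τ ∧ T.d (g • h • p) q + (σ + τ) = T.d p q := by
  have e1 := hg.total
  have e2 := hg.right
  have e3 := hg.left
  have f2 := hh.mid
  have f3 := hh.left
  have s1 := T.smul g p (h • p)
  have s2 := T.smul g (h • p) q
  have t3 := T.tri p (g • h • p) (g • q)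
  have t4 := T.tri p (g • p) (g • h • p)
  have key := T.d_of_between (P := p) (Q := g • q) (x := g • h • p) (y := q)
    (by omega) (by omega) (by omega)
  omega

/-- Two shifts of the same geodesic commute if it is long enough: the two products agree at two
different points. -/
lemma commute (hg : T.IsShift g p q σ) (hh : T.IsShift h p q τ) (hστ : σ + τ < T.d p q) :
    Commute g h := by
  have e := T.comm q p
  have a1 := hg.apply_apply hh hστ.le
  have a2 := hh.apply_apply hg (by omega)
  have b1 := hg.inv.apply_apply hh.inv (by omega)
  have b2 := hh.inv.apply_apply hg.inv (by omega)
  have c1 : g • h • p = h • g • p :=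
    T.eq_of_between (P := p) (Q := q) (by omega) (by omega) (by omega)
  have c2 : g⁻¹ • h⁻¹ • q = h⁻¹ • g⁻¹ • q :=
    T.eq_of_between (P := q) (Q := p) (by omega) (by omega) (by omega)
  have key : (h * g)⁻¹ * (g * h) = 1 := by
    refine T.free _ (x := p) (y := h⁻¹ • g⁻¹ • q) ?_ ?_ ?_
    · rw [mul_smul, mul_smul g h, c1, ← mul_smul h g, inv_smul_smul]
    · simp only [mul_smul, mul_inv_rev, smul_inv_smul, c2]
    · rintro hp
      have := b2.2
      rw [← hp, T.d_self] at this
      omega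
  exact (inv_mul_eq_one.mp key).symm

/-- A shift of a geodesic is determined by its amount. -/
lemma unique (hg : T.IsShift g p q σ) (hh : T.IsShift h p q σ) (hσ : σ < T.d p q) : g = h := by
  have c1 : g • p = h • p := T.eq_of_between (P := p) (Q := q)
    (by rw [hg.left, ← hg.mid, add_comm]) (by rw [hh.left, ← hh.mid, add_comm])
    (by rw [hg.left, hh.left])
  have c2 : g⁻¹ • q = h⁻¹ • q := T.eq_of_between (P := q) (Q := p)
    (by rw [hg.inv.left, ← hg.inv.mid, add_comm]) (by rw [hh.inv.left, ← hh.inv.mid, add_comm])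
    (by rw [hg.inv.left, hh.inv.left])
  have key : h⁻¹ * g = 1 := by
    refine T.free _ (x := p) (y := g⁻¹ • q) ?_ ?_ ?_
    · rw [mul_smul, c1, inv_smul_smul]
    · rw [mul_smul, smul_inv_smul, c2]
    · rintro hp
      have h1 := hg.inv.mid
      have h2 := T.comm q p
      rw [← hp, T.d_self] at h1
      omega
  exact (inv_mul_eq_one.mp key).symm

/-- A shift doubles its displacement at the start of the geodesic. -/
lemma d_sq (hg : T.IsShift g p q σ) : T.d p (g • g • p) = 2 * σ := by
  have e1 := hg.total
  have e3 := hg.left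
  have e4 := hg.mid
  have s1 := T.smul g p (g • p)
  have s2 := T.smul g (g • p) q
  have t1 := T.tri p (g • g • p) (g • q)
  have t2 := T.tri p (g • p) (g • g • p)
  omega

end IsShift

end TreeAction

/-! ### Hyperbolic elements -/

namespace TreeAction

variable {Γ V : Type*} [Group Γ] [MulAction Γ V] (T : TreeAction Γ V)

/-- The point `p` lies on the axis of the hyperbolic element `g`: the points `p`, `g p`, `g² p` are
different and lie in this order on a geodesic. -/
def OnAxis (g : Γ) (p : V) : Prop :=
  0 < T.d p (g • p) ∧ T.d p (g • g • p) = 2 * T.d p (g • p)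

/-- `g` is hyperbolic: it translates some line of the tree. -/
def Hyp (g : Γ) : Prop := ∃ p, T.OnAxis g p

variable {T}

lemma IsShift.onAxis {g : Γ} {p q : V} {σ : ℕ} (hg : T.IsShift g p q σ) (hσ : 0 < σ) :
    T.OnAxis g p := by
  refine ⟨?_, ?_⟩
  · rw [hg.left]; exact hσ
  · rw [hg.left, hg.d_sq]

namespace OnAxis

variable {g : Γ} {p : V}

/-- By induction with the four point condition, the displacement condition for `g ^ 2` propagates
to all powers. -/
lemma d_pow_succ (h : T.OnAxis g p) (k : ℕ) :
    T.d p (g ^ (k + 1) • p) = T.d p (g ^ k • p) + T.d p (g • p) := by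
  have key : ∀ k : ℕ, T.d p (g ^ (k + 1) • p) = T.d p (g ^ k • p) + T.d p (g • p) ∧
      (k = 0 ∨ 0 < T.d p (g ^ k • p)) := by
    intro k
    induction k with
    | zero => simp [T.d_self]
    | succ k ih =>
      obtain ⟨ih1, ih2⟩ := ih
      have e1 : T.d (g • p) (g ^ (k + 1) • p) = T.d p (g ^ k • p) := by
        rw [pow_succ', mul_smul, T.smul]
      have e2 : T.d (g • p) (g ^ (k + 1 + 1) • p) = T.d p (g ^ (k + 1) • p) := by
        rw [pow_succ' g (k + 1), mul_smul, T.smul]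
      have e3 : T.d (g ^ (k + 1) • p) (g ^ (k + 1 + 1) • p) = T.d p (g • p) := by
        rw [pow_succ g (k + 1), mul_smul, T.smul]
      have f := T.four p (g ^ (k + 1) • p) (g • p) (g ^ (k + 1 + 1) • p)
      have t := T.tri p (g ^ (k + 1) • p) (g ^ (k + 1 + 1) • p)
      have t2 := T.comm (g ^ (k + 1) • p) (g • p)
      have h1 := h.1
      refine ⟨?_, by omega⟩
      rcases Nat.eq_zero_or_pos k with rfl | hk
      · have h2 := h.2
        simpa [pow_two, mul_smul, two_mul] using h2
      · omega
  exact (key k).1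

lemma d_pow (h : T.OnAxis g p) (k : ℕ) : T.d p (g ^ k • p) = k * T.d p (g • p) := by
  induction k with
  | zero => simp [T.d_self]
  | succ k ih => rw [h.d_pow_succ, ih]; ring

/-- An element `a` commuting with `g` displaces far away points of the axis of `g` along this
axis: the distance of `p` to `a g ^ m p` grows with slope one as `m → ∞` and as `m → -∞`. -/
lemma d_commute (h : T.OnAxis g p) {a : Γ} (ha : Commute a g) {m : ℕ} (hm : T.d p (a • p) < m) :
    T.d p (a • g ^ (m + 1) • p) = T.d p (a • g ^ m • p) + T.d p (g • p) ∧
    T.d p (a • g ^ m • p) + T.d (g ^ m • p) (a • p) = 2 * (m * T.d p (g • p)) := by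
  have key : ∀ n : ℕ, T.d p (a • p) < n →
      T.d p (a • g ^ n • p) + T.d (g ^ n • p) (a • p) = 2 * (n * T.d p (g • p)) := by
    intro n hn
    have c : a • g ^ n • p = g ^ n • a • p := by
      rw [← mul_smul, ← mul_smul, (ha.pow_right n).eq]
    have e1 := h.d_pow n
    have e2 : T.d (a • p) (a • g ^ n • p) = n * T.d p (g • p) := by rw [T.smul, e1]
    have e3 : T.d (g ^ n • p) (a • g ^ n • p) = T.d p (a • p) := by rw [c, T.smul]
    have f1 := T.four p (g ^ n • p) (a • p) (a • g ^ n • p)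
    have f2 := T.four p (a • g ^ n • p) (g ^ n • p) (a • p)
    have c1 := T.comm (a • g ^ n • p) (a • p)
    have c2 := T.comm (a • g ^ n • p) (g ^ n • p)
    have h1 : n ≤ n * T.d p (g • p) := Nat.le_mul_of_pos_right _ h.1
    omega
  refine ⟨?_, key m hm⟩
  have k1 := key m hm
  have k2 := key (m + 1) (by omega)
  have s1 : T.d (a • g ^ m • p) (a • g ^ (m + 1) • p) = T.d p (g • p) := by
    rw [T.smul, pow_succ, mul_smul, T.smul]
  have s2 : T.d (g ^ m • p) (g ^ (m + 1) • p) = T.d p (g • p) := by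
    rw [pow_succ, mul_smul, T.smul]
  have t1 := T.tri p (a • g ^ m • p) (a • g ^ (m + 1) • p)
  have t2 := T.tri (g ^ (m + 1) • p) (g ^ m • p) (a • p)
  have c2 := T.comm (g ^ (m + 1) • p) (g ^ m • p)
  rw [add_one_mul] at k2
  omega

/-- The signed translation length of the elements commuting with `g` along the axis of `g` is an
injective homomorphism. It is obtained from a far away point of the axis, as the difference of
the positions of `a g ^ m p` and `g ^ m p` on the axis for large `m`. -/
lemma exists_translation (h : T.OnAxis g p) : ∃ f : Γ → ℤ,
    (∀ a, Commute a g → (T.d p (a • p) : ℤ) = |f a|) ∧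
    (∀ a c, Commute a g → Commute c g → f (a * c) = f a + f c) ∧
    (∀ a, Commute a g → f a = 0 → a = 1) ∧ f g = T.d p (g • p) := by
  obtain ⟨σ, hσ⟩ : ∃ σ, σ = T.d p (g • p) := ⟨_, rfl⟩
  have hdp : ∀ k : ℕ, T.d p (g ^ k • p) = k * σ := fun k => by rw [h.d_pow, hσ]
  rw [← hσ]
  let f : Γ → ℤ := fun a =>
    (T.d p (a • g ^ (T.d p (a • p) + 1) • p) : ℤ) - ((T.d p (a • p) + 1 : ℕ) : ℤ) * σ
  have hf : ∀ a, Commute a g → ∀ m : ℕ, T.d p (a • p) < m →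
      (T.d p (a • g ^ m • p) : ℤ) = m * σ + f a ∧ (T.d (g ^ m • p) (a • p) : ℤ) = m * σ - f a := by
    intro a ha m hm
    have h1 : (T.d p (a • g ^ m • p) : ℤ) = m * σ + f a := by
      induction m, (show T.d p (a • p) + 1 ≤ m from hm) using Nat.le_induction with
      | base => simp [f]
      | succ n hn ih =>
        have := (h.d_commute ha (m := n) (by omega)).1
        rw [this, ← hσ]
        push_cast
        rw [ih (by omega)]
        ring
    have h2 := (h.d_commute ha hm).2
    refine ⟨h1, ?_⟩
    have h3 : (T.d p (a • g ^ m • p) : ℤ) + T.d (g ^ m • p) (a • p) = 2 * (m * σ) := by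
      rw [hσ]; exact_mod_cast h2
    linarith
  -- `a p` lies on the axis, at the position `f a`
  have hpos : ∀ a, Commute a g → ∀ m N : ℕ, T.d p (a • p) < m → T.d p (a • p) + m < N →
      (T.d (a • g ^ m • p) (g ^ N • p) : ℤ) = ((N : ℤ) - m) * σ - f a := by
    intro a ha m N hm hN
    obtain ⟨k, rfl⟩ := Nat.exists_eq_add_of_lt hN
    have e : T.d (a • g ^ m • p) (g ^ (T.d p (a • p) + m + k + 1) • p) =
        T.d (g ^ (T.d p (a • p) + k + 1) • p) (a • p) := by
      rw [← mul_smul, (ha.pow_right m).eq, mul_smul,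
        show T.d p (a • p) + m + k + 1 = m + (T.d p (a • p) + k + 1) by omega, pow_add, mul_smul,
        T.smul, T.comm]
    rw [e, (hf a ha _ (by omega)).2]
    push_cast
    ring
  refine ⟨f, ?_, ?_, ?_, ?_⟩
  · intro a ha
    obtain ⟨M, hM⟩ : ∃ M, M = T.d p (a • p) + 1 := ⟨_, rfl⟩
    have h1 := hf a ha M (by omega)
    have e0 : T.d (g ^ M • p) (g ^ (M + M) • p) = M * σ := by
      rw [pow_add, mul_smul, T.smul, hdp]
    have e1 := hdp (M + M)
    have e2 := hdp M
    have e3 := hpos a ha M (M + M) (by omega) (by omega)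
    have e4 : T.d (g ^ M • p) (a • g ^ M • p) = T.d p (a • p) := by
      rw [← mul_smul, (ha.pow_right M).eq, mul_smul, T.smul]
    rw [add_mul] at e1
    have e3' : (T.d (a • g ^ M • p) (g ^ (M + M) • p) : ℤ) = M * σ - f a := by
      rw [e3]; push_cast; ring
    have h1' := h1.1
    have e5 : ((M : ℤ) * σ) = ((M * σ : ℕ) : ℤ) := by push_cast; rfl
    rw [e5] at h1' e3'
    generalize M * σ = Mσ at *
    rcases le_total (T.d p (g ^ M • p)) (T.d p (a • g ^ M • p)) with hle | hle
    · have := T.d_of_between (P := p) (Q := g ^ (M + M) • p) (x := g ^ M • p)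
        (y := a • g ^ M • p) (by omega) (by omega) hle
      rw [abs_of_nonneg (by omega)]
      omega
    · have := T.d_of_between (P := p) (Q := g ^ (M + M) • p) (x := a • g ^ M • p)
        (y := g ^ M • p) (by omega) (by omega) hle
      have c := T.comm (g ^ M • p) (a • g ^ M • p)
      rw [abs_of_nonpos (by omega)]
      omega
  · intro a c ha hc
    obtain ⟨m, hm⟩ : ∃ m, m = T.d p (a • p) + T.d p (c • p) + T.d p ((a * c) • p) + 1 := ⟨_, rfl⟩
    obtain ⟨N, hN⟩ : ∃ N, N = m + m + T.d p (c • p) + 1 := ⟨_, rfl⟩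
    have h1 := (hf a ha m (by omega)).1
    have h2 := (hf c hc m (by omega)).1
    have h3 := (hf (a * c) (ha.mul_left hc) (m + m) (by omega)).1
    have h4 := (hf a ha (m + N) (by omega)).1
    have h5 := hpos c hc m N (by omega) (by omega)
    have e1 : a • g ^ m • c • g ^ m • p = (a * c) • g ^ (m + m) • p := by
      rw [pow_add]
      simp only [← mul_smul]
      have e := (hc.pow_right m).eq
      simp only [mul_assoc] at e ⊢
      rw [← mul_assoc c (g ^ m), e]
      simp only [mul_assoc]
      rw [e]
    have s1 : T.d (a • g ^ m • p) (a • g ^ m • c • g ^ m • p) = T.d p (c • g ^ m • p) := by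
      rw [T.smul, T.smul]
    have s2 : T.d (a • g ^ m • c • g ^ m • p) (a • g ^ (m + N) • p) =
        T.d (c • g ^ m • p) (g ^ N • p) := by
      rw [T.smul, pow_add, mul_smul, T.smul]
    rw [e1] at s1 s2
    have t1 := T.tri p (a • g ^ m • p) ((a * c) • g ^ (m + m) • p)
    have t2 := T.tri p ((a * c) • g ^ (m + m) • p) (a • g ^ (m + N) • p)
    rw [s1] at t1
    rw [s2] at t2
    have t1' : (T.d p ((a * c) • g ^ (m + m) • p) : ℤ) ≤
      T.d p (a • g ^ m • p) + T.d p (c • g ^ m • p) := by exact_mod_cast t1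
    have t2' : (T.d p (a • g ^ (m + N) • p) : ℤ) ≤
      T.d p ((a * c) • g ^ (m + m) • p) + T.d (c • g ^ m • p) (g ^ N • p) := by exact_mod_cast t2
    rw [h1, h2, h3] at t1'
    rw [h3, h4, h5] at t2'
    push_cast at t1' t2'
    ring_nf at t1' t2'
    linarith
  · intro a ha h0
    obtain ⟨M, hM⟩ : ∃ M, M = T.d p (a • p) + 1 := ⟨_, rfl⟩
    have fix : ∀ m : ℕ, M ≤ m → a • g ^ m • p = g ^ m • p := by
      intro m hm
      have h1 := (hf a ha m (by omega)).1
      have h2 := hpos a ha m (m + M) (by omega) (by omega)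
      have e1 := hdp m
      have e2 := hdp (m + M)
      have e3 : T.d (g ^ m • p) (g ^ (m + M) • p) = M * σ := by
        rw [pow_add, mul_smul, T.smul, hdp]
      have h1' : T.d p (a • g ^ m • p) = m * σ := by
        zify; rw [h1, h0]; ring
      have h2' : T.d (a • g ^ m • p) (g ^ (m + M) • p) = M * σ := by
        zify; rw [h2, h0]; push_cast; ring
      rw [add_mul] at e2
      refine T.eq_of_between (P := p) (Q := g ^ (m + M) • p) ?_ ?_ ?_ <;> omega
    refine T.free a (fix M le_rfl) (fix (M + 1) (by omega)) ?_
    intro hq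
    have e : T.d (g ^ M • p) (g ^ (M + 1) • p) = σ := by
      rw [pow_succ, mul_smul, T.smul, hσ]
    rw [← hq, T.d_self] at e
    have := h.1
    omega
  · have h1 := (hf g (Commute.refl g) (σ + 1) (by omega)).1
    rw [← mul_smul, ← pow_succ', hdp] at h1
    push_cast at h1
    linarith

end OnAxis

variable {g a c x t : Γ}

/-- Commutation is transitive at a hyperbolic element. -/
lemma Hyp.commute (hg : T.Hyp g) (ha : Commute a g) (hc : Commute c g) : Commute a c := by
  obtain ⟨p, hp⟩ := hg
  obtain ⟨f, -, hadd, hinj, -⟩ := hp.exists_translation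
  have h1 := hadd a c ha hc
  have h2 := hadd c a hc ha
  have hinv : f (c * a)⁻¹ = - f (c * a) := by
    have hca := hc.mul_left ha
    have h3 := hadd _ _ hca hca.inv_left
    have h4 := hadd 1 1 (Commute.one_left g) (Commute.one_left g)
    rw [mul_inv_cancel] at h3
    rw [mul_one] at h4
    linarith
  have h5 := hadd (a * c) (c * a)⁻¹ (ha.mul_left hc) (hc.mul_left ha).inv_left
  have h6 := hinj _ ((ha.mul_left hc).mul_left (hc.mul_left ha).inv_left) (by rw [h5]; linarith)
  exact mul_inv_eq_one.mp h6

/-- The elements different from the identity which commute with a hyperbolic element are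
hyperbolic. -/
lemma Hyp.of_commute (hg : T.Hyp g) (ha : Commute a g) (h1 : a ≠ 1) : T.Hyp a := by
  obtain ⟨p, hp⟩ := hg
  obtain ⟨f, hd, hadd, hinj, -⟩ := hp.exists_translation
  have h0 : f a ≠ 0 := fun h => h1 (hinj a ha h)
  have e1 := hd a ha
  have e2 := hd (a * a) (ha.mul_left ha)
  rw [hadd a a ha ha, ← two_mul, abs_mul, abs_two, mul_smul, ← e1] at e2
  refine ⟨p, ?_, ?_⟩
  · have := abs_pos.mpr h0
    omega
  · exact_mod_cast e2

lemma Hyp.conj (hg : T.Hyp g) (k : Γ) : T.Hyp (k * g * k⁻¹) := by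
  obtain ⟨p, h1, h2⟩ := hg
  exact ⟨k • p, by simpa [mul_smul, T.smul] using h1, by simpa [mul_smul, T.smul] using h2⟩

/-- A conjugate of `t` which commutes with the hyperbolic element `t` has the same translation
length, hence is `t` or its inverse. -/
lemma Hyp.conj_eq (ht : T.Hyp t) (hx : Commute (x * t * x⁻¹) t) :
    x * t * x⁻¹ = t ∨ x * t * x⁻¹ = t⁻¹ := by
  obtain ⟨p, hp⟩ := ht
  obtain ⟨f, hd, hadd, hinj, hft⟩ := hp.exists_translation
  have hpow : ∀ a, Commute a t → ∀ k : ℕ, f (a ^ k) = k * f a := by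
    intro a ha k
    induction k with
    | zero =>
      have h4 := hadd 1 1 (Commute.one_left t) (Commute.one_left t)
      rw [mul_one] at h4
      simp; linarith
    | succ k ih => rw [pow_succ, hadd _ _ (ha.pow_left k) ha, ih]; push_cast; ring
  have hsub : ∀ a b, Commute a t → Commute b t → f a = f b → a = b := by
    intro a b ha hb hab
    have h3 := hadd (a * b⁻¹) b (ha.mul_left hb.inv_left) hb
    rw [inv_mul_cancel_right] at h3
    exact mul_inv_eq_one.mp (hinj _ (ha.mul_left hb.inv_left) (by linarith))
  set s := x * t * x⁻¹ with hs
  obtain ⟨σ, hσ⟩ : ∃ σ, σ = T.d p (t • p) := ⟨_, rfl⟩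
  set D := T.d p (x⁻¹ • p) with hD
  -- the displacements of `p` by the powers of `s` and of `t` differ by a bounded amount
  have hbound : ∀ k : ℕ, (k : ℤ) * |f s| ≤ k * σ + 2 * D ∧ (k : ℤ) * σ ≤ k * |f s| + 2 * D := by
    intro k
    have e1 := hd (s ^ k) (hx.pow_left k)
    rw [hpow s hx, abs_mul, Nat.abs_cast] at e1
    have e2 : T.d p (s ^ k • p) = T.d (x⁻¹ • p) (t ^ k • x⁻¹ • p) := by
      rw [hs, conj_pow, mul_smul, mul_smul, ← T.smul x (x⁻¹ • p), smul_inv_smul]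
    have e3 := hp.d_pow k
    rw [← hσ] at e3
    have t1 := T.tri (x⁻¹ • p) p (t ^ k • x⁻¹ • p)
    have t2 := T.tri p (t ^ k • p) (t ^ k • x⁻¹ • p)
    have t3 := T.tri p (x⁻¹ • p) (t ^ k • p)
    have t4 := T.tri (x⁻¹ • p) (t ^ k • x⁻¹ • p) (t ^ k • p)
    rw [T.smul] at t2
    rw [T.smul] at t4
    have c := T.comm p (x⁻¹ • p)
    rw [← e1, e2]
    constructor
    · have : T.d (x⁻¹ • p) (t ^ k • x⁻¹ • p) ≤ k * σ + 2 * D := by omega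
      exact_mod_cast this
    · have : k * σ ≤ T.d (x⁻¹ • p) (t ^ k • x⁻¹ • p) + 2 * D := by omega
      exact_mod_cast this
  have habs : |f s| = σ := by
    have b := hbound (2 * D + 1)
    push_cast at b
    obtain ⟨b1, b2⟩ := b
    have hD0 : (0 : ℤ) ≤ D := by positivity
    apply le_antisymm
    · by_contra hlt
      push Not at hlt
      nlinarith
    · by_contra hlt
      push Not at hlt
      nlinarith
  have hneg : f t⁻¹ = - f t := by
    have h3 := hadd t t⁻¹ (Commute.refl t) (Commute.refl t).inv_left
    have h4 := hadd 1 1 (Commute.one_left t) (Commute.one_left t)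
    rw [mul_inv_cancel] at h3
    rw [mul_one] at h4
    linarith
  rcases eq_or_eq_neg_of_abs_eq habs with h | h
  · exact Or.inl (hsub _ _ hx (Commute.refl t) (by rw [h, hft, hσ]))
  · exact Or.inr (hsub _ _ hx (Commute.refl t).inv_left (by rw [h, hneg, hft, hσ]))

end TreeAction

/-! ### Collisions between reduced products -/

namespace TreeAction

variable {Γ V : Type*} [Group Γ] [MulAction Γ V] (T : TreeAction Γ V) (o : V)

/-- The displacement of the base point `o` by `g`. -/
def len (g : Γ) : ℕ := T.d o (g • o)

lemma d_smul_smul (g h : Γ) : T.d (g • o) (h • o) = T.len o (g⁻¹ * h) := by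
  rw [len, mul_smul, T.comm o, T.d_inv_smul, T.comm]

lemma len_inv (g : Γ) : T.len o g⁻¹ = T.len o g := by
  rw [len, T.comm, T.d_inv_smul, len]

lemma len_mul_le (g h : Γ) : T.len o (g * h) ≤ T.len o g + T.len o h := by
  have := T.tri o (g • o) ((g * h) • o)
  rwa [d_smul_smul, inv_mul_cancel_left] at this

/-- The element `s` translates, by `τ`, an initial segment of the geodesic from `o` to `u o` of
length at least `2 τ`. -/
def BeginsPeriodic (u s : Γ) (τ : ℕ) : Prop :=
  ∃ w, T.d o w + T.d w (u • o) = T.len o u ∧ 2 * τ ≤ T.d o w ∧ T.IsShift s o w τ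

variable {T o}

/-- The product `a b c` is reduced: the geodesic from `o` to `a b c o` passes through `a o` and
then through `a b o`. -/
def Reduced (T : TreeAction Γ V) (o : V) (a b c : Γ) : Prop :=
  T.len o (a * b * c) = T.len o a + T.len o b + T.len o c

lemma Reduced.inv {a b c : Γ} (h : T.Reduced o a b c) : T.Reduced o c⁻¹ b⁻¹ a⁻¹ := by
  unfold Reduced at *
  have e : c⁻¹ * b⁻¹ * a⁻¹ = (a * b * c)⁻¹ := by group
  rw [e, len_inv, len_inv, len_inv, len_inv, h]
  omega

/-- Both partial products of a reduced product are reduced. -/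
lemma Reduced.eqs {a b c : Γ} (h : T.Reduced o a b c) :
    T.len o (a * b) = T.len o a + T.len o b ∧ T.len o (b * c) = T.len o b + T.len o c := by
  unfold Reduced at *
  have h1 := T.len_mul_le o (a * b) c
  have h2 := T.len_mul_le o a b
  have h3 := T.len_mul_le o a (b * c)
  have h4 := T.len_mul_le o b c
  rw [← mul_assoc] at h3
  omega

/-- Two factorisations of the same element with the same middle factor `b` give a translation of
the geodesic from `o` to `b o`. -/
lemma isShift_of_collision {u v u' v' b : Γ} (h : T.Reduced o u b v) (h' : T.Reduced o u' b v')
    (heq : u * b * v = u' * b * v') (h1 : T.len o u ≤ T.len o u')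
    (h2 : T.len o u' ≤ T.len o u + T.len o b) :
    T.IsShift (u⁻¹ * u') o (b • o) (T.len o u' - T.len o u) := by
  have e := h.eqs
  have e' := h'.eqs
  unfold Reduced at h h'
  rw [heq] at h
  have key : ∀ k : Γ, T.d (u⁻¹ • o) (k • o) = T.len o (u * k) ∧
      T.d (k • o) ((b * v) • o) = T.len o (k⁻¹ * (b * v)) := fun k =>
    ⟨by rw [d_smul_smul, inv_inv], by rw [d_smul_smul]⟩
  have k1 := key 1
  have k2 := key b
  have k3 := key (u⁻¹ * u')
  have k4 := key (u⁻¹ * u' * b)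
  have k5 := (key (b * v)).1
  rw [← mul_assoc, heq] at k5
  have r3 : (u⁻¹ * u')⁻¹ * (b * v) = b * v' := by
    rw [mul_inv_rev, inv_inv, mul_assoc, ← mul_assoc u, heq]; group
  have r4 : (u⁻¹ * u' * b)⁻¹ * (b * v) = v' := by
    rw [mul_inv_rev, mul_assoc, r3]; group
  rw [r3, mul_inv_cancel_left] at k3
  rw [r4, mul_assoc u⁻¹, mul_inv_cancel_left, ← mul_assoc u⁻¹, mul_smul _ b] at k4
  rw [inv_mul_cancel_left] at k2
  simp only [one_smul, mul_one, inv_one, one_mul] at k1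
  obtain ⟨k1, k1'⟩ := k1
  obtain ⟨k2, k2'⟩ := k2
  obtain ⟨k3, k3'⟩ := k3
  obtain ⟨k4, k4'⟩ := k4
  obtain ⟨e1, e2⟩ := e
  obtain ⟨e3, e4⟩ := e'
  clear key r3 r4 heq
  refine isShift_of_between (P := u⁻¹ • o) (Q := (b * v) • o) ?_ ?_ ?_ ?_ ?_ ?_ ?_
  · rw [k1, k1', k5]; omega
  · rw [k2, k2', k5]; omega
  · rw [k3, k3', k5]; omega
  · rw [k4, k4', k5]; omega
  · rw [k3, k1]; omega
  · rw [k4, k2]; omega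
  · rw [k1, k2]; omega

/-- Two different factorisations of an element have outer factors of different lengths, since
only the identity fixes both ends of the geodesic from `o` to `b o`. -/
lemma eq_of_collision {u v u' v' b : Γ} (h : T.Reduced o u b v) (h' : T.Reduced o u' b v')
    (heq : u * b * v = u' * b * v') (h1 : T.len o u = T.len o u') (hb : 0 < T.len o b) :
    u = u' := by
  have hs := isShift_of_collision h h' heq h1.le (by omega)
  have h0 : T.len o u' - T.len o u = 0 := by omega
  rw [h0] at hs
  have h2 : (u⁻¹ * u') = 1 := by
    refine T.free _ (x := o) (y := b • o) (T.eq_of_d hs.left).symm (T.eq_of_d hs.right).symm ?_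
    intro hbo
    rw [len, ← hbo, T.d_self] at hb
    omega
  exact inv_mul_eq_one.mp h2

/-- If `u₁ b v₁ = u₂ b v₂ = u₃ b v₃` with `u₁`, `u₂`, `u₃` of increasing length, then the
shortest translation `t` of the geodesic from `o` to `b o` commutes with `u₁⁻¹ u₃`. Since
`v₁ = b⁻¹ (u₁⁻¹ u₃) b v₃`, the geodesic from `o` to `v₁ o` starts with a segment translated by the
conjugate `b⁻¹ t b`. -/
lemma beginsPeriodic_of_collisions {u₁ u₂ u₃ v₁ v₂ v₃ b t : Γ} {τ : ℕ}
    (r₁ : T.Reduced o u₁ b v₁) (r₂ : T.Reduced o u₂ b v₂) (r₃ : T.Reduced o u₃ b v₃)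
    (e₂ : u₁ * b * v₁ = u₂ * b * v₂) (e₃ : u₁ * b * v₁ = u₃ * b * v₃)
    (l₁₂ : T.len o v₂ < T.len o v₁) (l₂₃ : T.len o v₃ < T.len o v₂)
    (l₃ : 0 < T.len o v₃) (l₁ : T.len o v₁ ≤ T.len o b) (ht : T.IsShift t o (b • o) τ)
    (hmin : ∀ t' τ', 0 < τ' → T.IsShift t' o (b • o) τ' → τ ≤ τ') :
    T.BeginsPeriodic o v₁ (b⁻¹ * t * b) τ := by
  have q₁ : _ = _ := r₁
  have q₂ : _ = _ := r₂
  have q₃ : _ = _ := r₃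
  rw [← e₂] at q₂
  rw [← e₃] at q₃
  have s₁₂ := isShift_of_collision r₁ r₂ e₂ (by omega) (by omega)
  have s₂₃ := isShift_of_collision r₂ r₃ (e₂.symm.trans e₃) (by omega) (by omega)
  have s₁₃ := isShift_of_collision r₁ r₃ e₃ (by omega) (by omega)
  have m₁₂ := hmin _ _ (by omega) s₁₂
  have m₂₃ := hmin _ _ (by omega) s₂₃
  have hb : T.d o (b • o) = T.len o b := rfl
  have c₁ := ht.commute s₁₂ (by omega)
  have c₂ := ht.commute s₂₃ (by omega)
  obtain ⟨h, hh⟩ : ∃ h, h = u₁⁻¹ * u₃ := ⟨_, rfl⟩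
  have c : Commute t h := by
    have := c₁.mul_right c₂
    rwa [show u₁⁻¹ * u₂ * (u₂⁻¹ * u₃) = h by rw [hh]; group] at this
  rw [← hh] at s₁₃
  have hv : v₁ = b⁻¹ * h * b * v₃ := by
    rw [hh, mul_assoc, mul_assoc, mul_assoc, ← mul_assoc u₃, ← e₃]; group
  have d1 := s₁₃.right
  have d2 := s₁₃.inv.left
  have d3 := s₁₃.inv.mid
  have w1 : T.d o ((b⁻¹ * h * b) • o) = T.d (b • o) (h • b • o) := by
    rw [T.comm, mul_assoc, mul_smul, T.d_inv_smul, mul_smul, T.comm]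
  refine ⟨(b⁻¹ * h * b) • o, ?_, by omega, ?_⟩
  · have w2 : T.d ((b⁻¹ * h * b) • o) (v₁ • o) = T.len o v₃ := by
      rw [hv, mul_smul _ v₃, T.smul]; rfl
    omega
  · have c1 := T.comm (b • o) o
    have c2 := T.comm (b • o) (h⁻¹ • b • o)
    have c3 := T.comm o (h⁻¹ • b • o)
    have := (ht.restrict_right (r := h⁻¹ • b • o) (by omega) (by omega)).conj (b⁻¹ * h)
    have e1 : (b⁻¹ * h) * t * (b⁻¹ * h)⁻¹ = b⁻¹ * t * b := by
      rw [mul_assoc b⁻¹, ← c.eq]; group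
    have e2 : (b⁻¹ * h) • h⁻¹ • b • o = o := by
      rw [mul_smul, smul_inv_smul, inv_smul_smul]
    have e3 : (b⁻¹ * h) • b • o = (b⁻¹ * h * b) • o := by rw [mul_smul _ b]
    rwa [e1, e2, e3] at this

/-- Suppose that `s` translates both the geodesic ending with `v' o`, moved to end in `o`, and a
long initial segment of the geodesic from `o` to `u o`. If `v u w = v' u w'` with `v` shorter
than `v'`, then `v⁻¹ v'` commutes with `s`. -/
lemma commute_of_collision {v v' u w w' s : Γ} {τ : ℕ}
    (r : T.Reduced o v u w) (r' : T.Reduced o v' u w') (e : v * u * w = v' * u * w')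
    (l : T.len o v < T.len o v') (hτ : 0 < τ) (hs : T.IsShift s (v'⁻¹ • o) o τ)
    (hu : T.BeginsPeriodic o u s τ) : Commute (v⁻¹ * v') s := by
  obtain ⟨p, hp, hτp, hsp⟩ := hu
  have q : _ = _ := r
  have q' : _ = _ := r'
  have a := r.eqs
  have a' := r'.eqs
  rw [← e] at q'
  obtain ⟨ω, hω⟩ : ∃ ω, ω = T.len o v' - T.len o v := ⟨_, rfl⟩
  have hlu : T.d o (u • o) = T.len o u := rfl
  -- `ω` is the amount by which `v⁻¹ v'` translates the geodesic from `o` to `u o`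
  by_cases hc : ω + τ < T.d o p ∨ ω = τ
  · have hy := isShift_of_collision r r' e l.le (by omega)
    rw [← hω] at hy
    have hy' := hy.restrict_left (r := p) hp (by omega)
    rcases hc with hc | hc
    · exact hy'.commute hsp hc
    · rw [hc] at hy'
      rw [hy'.unique hsp (by omega)]
  · push Not at hc
    have z1 : T.d o ((v * u * w) • o) = T.len o (v * u * w) := rfl
    -- `v o`, `v p` and `v' o` lie on the geodesic from `o` to `v u w o`
    have p1 : T.d o (v • o) = T.len o v := rfl
    have p2 : T.d (v • o) ((v * u * w) • o) = T.len o (u * w) := by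
      rw [d_smul_smul, mul_assoc, inv_mul_cancel_left]
    have p3 : T.d o (v' • o) = T.len o v' := rfl
    have p4 : T.d (v' • o) ((v * u * w) • o) = T.len o (u * w') := by
      rw [e, d_smul_smul, mul_assoc, inv_mul_cancel_left]
    have p5 := T.tri o (v • o) (v • p)
    rw [T.smul] at p5
    have p6 := T.tri (v • p) ((v * u) • o) ((v * u * w) • o)
    rw [mul_smul v u, T.smul, ← mul_smul, d_smul_smul, inv_mul_cancel_left] at p6
    have p7 := T.tri o (v • p) ((v * u * w) • o)
    have b1 := T.d_of_between (P := o) (Q := (v * u * w) • o) (x := v • o) (y := v' • o)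
      (by omega) (by omega) (by omega)
    have hω' : T.d (v • o) (v' • o) = ω := by omega
    have hτω : τ < ω := by omega
    have P1 : T.d o (v • p) = T.len o v + T.d o p := by omega
    have P2 : T.d o (v • p) + T.d (v • p) ((v * u * w) • o) = T.d o ((v * u * w) • o) := by omega
    have P3 : T.d o (v' • o) + T.d (v' • o) ((v * u * w) • o) = T.d o ((v * u * w) • o) := by
      omega
    have P4 : T.d o (v' • o) = T.len o v + ω := by omega
    have P5 : T.len o v' = T.len o v + ω := by omega
    clear b1 p1 p2 p3 p4 p5 p6 p7 z1 a a' q q' hlu hp e l hc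
    obtain ⟨y, hy⟩ : ∃ y, y = v⁻¹ * v' := ⟨_, rfl⟩
    have y1 : y⁻¹ • o = v'⁻¹ • v • o := by rw [hy, mul_inv_rev, inv_inv, mul_smul]
    have y2 : y⁻¹ • p = v'⁻¹ • v • p := by rw [hy, mul_inv_rev, inv_inv, mul_smul]
    have d1 : T.d (v'⁻¹ • o) (y⁻¹ • o) = T.len o v := by rw [y1, T.smul]; rfl
    have d2 : T.d (y⁻¹ • o) o = T.d (v • o) (v' • o) := by rw [y1, T.d_inv_smul]
    have d3 : T.d (v'⁻¹ • o) o = T.len o v' := by rw [T.d_inv_smul]; rfl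
    have d4 : T.d (y⁻¹ • o) (y⁻¹ • p) = T.d o p := T.smul _ _ _
    have d5 : T.d (y⁻¹ • p) o = T.d (v • p) (v' • o) := by rw [y2, T.d_inv_smul]
    have A := hs.restrict_right (r := y⁻¹ • o) (by omega) (by omega)
    have B := hsp.conj y⁻¹
    rw [inv_inv] at B
    -- `s` and its conjugate by `y⁻¹` translate a common geodesic by the same amount `τ`; depending
    -- on the order of `v p` and `v' o` it ends in `y⁻¹ p` or in `o`
    have key : y⁻¹ * s * y = s := by
      rcases le_total (T.d o p) ω with hN | hN
      · have b2 := T.d_of_between P2 P3 (by omega)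
        exact B.unique (A.restrict_left (r := y⁻¹ • p) (by omega) (by omega)) (by omega)
      · have b2 := T.d_of_between P3 P2 (by omega)
        have c := T.comm (v • p) (v' • o)
        have c2 := T.comm o (y⁻¹ • p)
        exact (B.restrict_left (r := o) (by omega) (by omega)).unique A (by omega)
    rw [← hy]
    rw [mul_assoc, inv_mul_eq_iff_eq_mul] at key
    exact key.symm

end TreeAction

/-! ### Counting in fibres -/

section Counting

/-- If `key` separates the elements of each fibre of `f`, and no two elements with the property `Q`
in a fibre have different keys, then each fibre contains at most one such element. -/
lemma card_filter_le_card_image {ι κ : Type*} [DecidableEq κ] {P : Finset ι} {f : ι → κ}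
    {key : ι → ℕ}
    (hinj : ∀ i ∈ P, ∀ j ∈ P, f i = f j → key i = key j → i = j) {Q : ι → Prop} [DecidablePred Q]
    (hQ : ∀ i ∈ P, ∀ j ∈ P, Q i → Q j → f i = f j → ¬ key i < key j) :
    (P.filter Q).card ≤ (P.image f).card := by
  refine Finset.card_le_card_of_injOn f ?_ ?_
  · intro i hi
    exact Finset.mem_image_of_mem f (Finset.mem_filter.mp hi).1
  · intro i hi j hj hij
    obtain ⟨hi, hi'⟩ := Finset.mem_filter.mp hi
    obtain ⟨hj, hj'⟩ := Finset.mem_filter.mp hj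
    have h1 := hQ i hi j hj hi' hj' hij
    have h2 := hQ j hj i hi hj' hi' hij.symm
    exact hinj i hi j hj hij (by omega)

/-- If the elements of a fibre of `f` with two smaller elements in the fibre have the property `Q`,
then all but two elements of each fibre have it. -/
lemma card_le_card_filter_above_add {ι κ : Type*} [DecidableEq κ] {P : Finset ι} {f : ι → κ}
    {key : ι → ℕ}
    (hinj : ∀ i ∈ P, ∀ j ∈ P, f i = f j → key i = key j → i = j) {Q : ι → Prop} [DecidablePred Q]
    (hQ : ∀ i ∈ P, ∀ j ∈ P, ∀ k ∈ P, f j = f i → f k = f i → key k < key j → key j < key i → Q i) :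
    P.card ≤ (P.filter Q).card + 2 * (P.image f).card := by
  classical
  have h0 := card_filter_le_card_image hinj
    (Q := fun i => ¬ Q i ∧ ¬ ∃ j ∈ P, f j = f i ∧ key j < key i)
    (fun i hi j hj _ hj' hij hlt => hj'.2 ⟨i, hi, hij, hlt⟩)
  have h1 := card_filter_le_card_image hinj
    (Q := fun i => ¬ Q i ∧ ∃ j ∈ P, f j = f i ∧ key j < key i) (by
      rintro i hi j hj ⟨-, k, hk, hki, hlt⟩ ⟨hj', -⟩ hij hlt'
      exact hj' (hQ j hj i hi k hk hij (hki.trans hij) hlt hlt'))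
  have h2 := Finset.card_filter_add_card_filter_not (s := P) Q
  have h3 := Finset.card_filter_add_card_filter_not (s := P.filter (fun i => ¬ Q i))
    (fun i => ∃ j ∈ P, f j = f i ∧ key j < key i)
  simp only [Finset.filter_filter] at h3
  omega

/-- If the elements of a fibre of `f` with a smaller and a larger element in the fibre have the
property `Q`, then all but two elements of each fibre have it. -/
lemma card_le_card_filter_between_add {ι κ : Type*} [DecidableEq κ] {P : Finset ι} {f : ι → κ}
    {key : ι → ℕ}
    (hinj : ∀ i ∈ P, ∀ j ∈ P, f i = f j → key i = key j → i = j) {Q : ι → Prop} [DecidablePred Q]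
    (hQ : ∀ i ∈ P, ∀ j ∈ P, ∀ k ∈ P, f j = f i → f k = f i → key j < key i → key i < key k → Q i) :
    P.card ≤ (P.filter Q).card + 2 * (P.image f).card := by
  classical
  have h0 := card_filter_le_card_image hinj
    (Q := fun i => ¬ Q i ∧ ¬ ∃ j ∈ P, f j = f i ∧ key j < key i)
    (fun i hi j hj _ hj' hij hlt => hj'.2 ⟨i, hi, hij, hlt⟩)
  have h1 := card_filter_le_card_image hinj
    (Q := fun i => ¬ Q i ∧ ∃ j ∈ P, f j = f i ∧ key j < key i) (by
      rintro i hi j hj ⟨hi', k, hk, hki, hlt⟩ - hij hlt'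
      exact hi' (hQ i hi k hk j hj hki hij.symm hlt hlt'))
  have h2 := Finset.card_filter_add_card_filter_not (s := P) Q
  have h3 := Finset.card_filter_add_card_filter_not (s := P.filter (fun i => ¬ Q i))
    (fun i => ∃ j ∈ P, f j = f i ∧ key j < key i)
  simp only [Finset.filter_filter] at h3
  omega

/-- Double counting: if on average a proportion `c / e` of the `b ∈ B` is related to `a ∈ A`,
then some `b ∈ B` is related to a proportion `c / e` of `A`. -/
lemma exists_mul_card_le_filter {α β : Type*} {A : Finset α} {B : Finset β} (R : α → β → Prop)
    [∀ a, DecidablePred (R a)] [∀ b, DecidablePred (fun a => R a b)] {c e : ℕ} (hB : B.Nonempty)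
    (h : c * (A.card * B.card) ≤ e * ∑ a ∈ A, (B.filter (R a)).card) :
    ∃ b ∈ B, c * A.card ≤ e * (A.filter (fun a => R a b)).card := by
  by_contra! hlt
  have e1 : ∑ a ∈ A, (B.filter (R a)).card = ∑ b ∈ B, (A.filter (fun a => R a b)).card :=
    Finset.sum_card_bipartiteAbove_eq_sum_card_bipartiteBelow R
  have h2 : ∑ b ∈ B, e * (A.filter (fun a => R a b)).card < ∑ _b ∈ B, c * A.card :=
    Finset.sum_lt_sum_of_nonempty hB hlt
  rw [← Finset.mul_sum, ← e1, Finset.sum_const, smul_eq_mul] at h2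
  have : B.card * (c * A.card) = c * (A.card * B.card) := by ring
  omega

lemma sum_card_filter_eq {α β : Type*} (A : Finset α) (B : Finset β) (R : α → β → Prop)
    [∀ a, DecidablePred (R a)] [DecidablePred (fun p : α × β => R p.1 p.2)] :
    ∑ a ∈ A, (B.filter (R a)).card = ((A ×ˢ B).filter (fun p => R p.1 p.2)).card := by
  rw [Finset.card_filter, Finset.sum_product]
  refine Finset.sum_congr rfl fun a _ => ?_
  rw [Finset.card_filter]
  congr!

/-- If all but `2 * m` of `a ^ 2` pairs are good, and a pair can only be good if its first (or its
second) coordinate is one of `r` good elements, then more than seven eighths of the elements are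
good. -/
lemma seven_mul_lt_eight_mul {a r q m : ℕ} (h1 : a ^ 2 ≤ q + 2 * m) (h2 : 16 * m < a ^ 2)
    (h3 : q ≤ a * r) : 7 * a < 8 * r := by
  have h : a * (7 * a) < a * (8 * r) := by
    have e1 : a * (7 * a) = 7 * a ^ 2 := by ring
    have e2 : a * (8 * r) = 8 * (a * r) := by ring
    omega
  exact lt_of_mul_lt_mul_left h (Nat.zero_le _)

end Counting

/-! ### Periods forced by few triple products -/

namespace TreeAction

variable {Γ V : Type*} [Group Γ] [MulAction Γ V] {T : TreeAction Γ V} {o : V}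

open Classical in
/-- If there are few products `u b v` with `u, v ∈ U`, then the geodesic from `o` to `b o` has a
translation `t`, and for most `u ∈ U` the geodesics from `o` to `u o` and to `u⁻¹ o` start with
long segments translated by the conjugates of `t` belonging to the two ends of `b`. -/
lemma exists_period {U : Finset Γ} {b : Γ} (hr : ∀ u ∈ U, ∀ v ∈ U, T.Reduced o u b v)
    (hl : ∀ u ∈ U, 0 < T.len o u ∧ T.len o u ≤ T.len o b)
    (hcard : 16 * ((U ×ˢ U).image (fun p => p.1 * b * p.2)).card < U.card ^ 2) :
    ∃ (t : Γ) (τ : ℕ), 0 < τ ∧ T.IsShift t o (b • o) τ ∧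
      3 * U.card ≤ 4 * (U.filter (fun u => T.BeginsPeriodic o u (b⁻¹ * t * b) τ ∧
        T.BeginsPeriodic o u⁻¹ t⁻¹ τ)).card := by
  set P := U ×ˢ U with hP
  set f : Γ × Γ → Γ := fun p => p.1 * b * p.2 with hf
  have hmem : ∀ p ∈ P, p.1 ∈ U ∧ p.2 ∈ U := fun p hp => Finset.mem_product.mp hp
  have hb : ∀ p ∈ P, 0 < T.len o b := fun p hp => by
    have := hl _ (hmem p hp).1
    omega
  have hred : ∀ p ∈ P, T.len o (f p) = T.len o p.1 + T.len o b + T.len o p.2 := fun p hp =>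
    hr _ (hmem p hp).1 _ (hmem p hp).2
  have hinjU : ∀ i ∈ P, ∀ j ∈ P, f i = f j → T.len o i.1 = T.len o j.1 → i = j := by
    intro i hi j hj hij hlen
    have h1 := eq_of_collision (hr _ (hmem i hi).1 _ (hmem i hi).2)
      (hr _ (hmem j hj).1 _ (hmem j hj).2) hij hlen (hb i hi)
    refine Prod.ext h1 ?_
    simp only [hf] at hij
    rw [h1] at hij
    exact mul_left_cancel hij
  have hinjV : ∀ i ∈ P, ∀ j ∈ P, f i = f j → T.len o i.2 = T.len o j.2 → i = j := by
    intro i hi j hj hij hlen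
    refine hinjU i hi j hj hij ?_
    have h1 := hred i hi
    have h2 := hred j hj
    rw [hij] at h1
    omega
  have hkey : ∀ i ∈ P, ∀ j ∈ P, f i = f j → (T.len o i.1 < T.len o j.1 ↔
      T.len o j.2 < T.len o i.2) := by
    intro i hi j hj hij
    have h1 := hred i hi
    have h2 := hred j hj
    rw [hij] at h1
    omega
  -- the pairs with two longer left factors, and those with two shorter ones, in their fibre
  set QV : Γ × Γ → Prop := fun i => ∃ j ∈ P, ∃ k ∈ P, f j = f i ∧ f k = f i ∧
    T.len o k.2 < T.len o j.2 ∧ T.len o j.2 < T.len o i.2 with hQV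
  set QU : Γ × Γ → Prop := fun i => ∃ j ∈ P, ∃ k ∈ P, f j = f i ∧ f k = f i ∧
    T.len o k.1 < T.len o j.1 ∧ T.len o j.1 < T.len o i.1 with hQU
  have cV : P.card ≤ (P.filter QV).card + 2 * (P.image f).card :=
    card_le_card_filter_above_add hinjV
      fun i _ j hj k hk h1 h2 h3 h4 => ⟨j, hj, k, hk, h1, h2, h3, h4⟩
  have cU : P.card ≤ (P.filter QU).card + 2 * (P.image f).card :=
    card_le_card_filter_above_add hinjU
      fun i _ j hj k hk h1 h2 h3 h4 => ⟨j, hj, k, hk, h1, h2, h3, h4⟩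
  have hPc : P.card = U.card ^ 2 := by rw [hP, Finset.card_product, sq]
  -- the shortest translation of the geodesic from `o` to `b o`
  have hex : ∃ τ, 0 < τ ∧ ∃ t, T.IsShift t o (b • o) τ := by
    have hpos : 0 < (P.filter QV).card := by omega
    obtain ⟨i, hi⟩ := Finset.card_pos.mp hpos
    obtain ⟨hi, j, hj, k, hk, hji, hki, h1, h2⟩ := Finset.mem_filter.mp hi
    have h3 := (hkey i hi j hj hji.symm).mpr h2
    have hli := hl _ (hmem i hi).1
    have hlj := hl _ (hmem j hj).1
    exact ⟨_, Nat.sub_pos_of_lt h3, _, isShift_of_collision (hr _ (hmem i hi).1 _ (hmem i hi).2)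
      (hr _ (hmem j hj).1 _ (hmem j hj).2) hji.symm h3.le (by omega)⟩
  obtain ⟨hτ, t, ht⟩ := Nat.find_spec hex
  set τ := Nat.find hex with hτdef
  have hmin : ∀ t' τ', 0 < τ' → T.IsShift t' o (b • o) τ' → τ ≤ τ' := fun t' τ' h0 h =>
    Nat.find_min' hex ⟨h0, t', h⟩
  refine ⟨t, τ, hτ, ht, ?_⟩
  have hV : ∀ i ∈ P.filter QV, T.BeginsPeriodic o i.2 (b⁻¹ * t * b) τ := by
    intro i hi
    obtain ⟨hi, j, hj, k, hk, hji, hki, h1, h2⟩ := Finset.mem_filter.mp hi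
    exact beginsPeriodic_of_collisions (hr _ (hmem i hi).1 _ (hmem i hi).2)
      (hr _ (hmem j hj).1 _ (hmem j hj).2) (hr _ (hmem k hk).1 _ (hmem k hk).2)
      hji.symm hki.symm h2 h1 (hl _ (hmem k hk).2).1 (hl _ (hmem i hi).2).2 ht hmin
  have hU : ∀ i ∈ P.filter QU, T.BeginsPeriodic o i.1⁻¹ t⁻¹ τ := by
    intro i hi
    obtain ⟨hi, j, hj, k, hk, hji, hki, h1, h2⟩ := Finset.mem_filter.mp hi
    have inv : ∀ p q : Γ × Γ, f q = f p →
        p.2⁻¹ * b⁻¹ * p.1⁻¹ = q.2⁻¹ * b⁻¹ * q.1⁻¹ := by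
      intro p q hpq
      have : (f p)⁻¹ = (f q)⁻¹ := by rw [hpq]
      simpa [hf, mul_assoc] using this
    have ht' : T.IsShift (b⁻¹ * t⁻¹ * b) o (b⁻¹ • o) τ := by
      have := ht.inv.conj b⁻¹
      rwa [inv_inv, inv_smul_smul] at this
    have := beginsPeriodic_of_collisions (t := b⁻¹ * t⁻¹ * b) (τ := τ)
      (hr _ (hmem i hi).1 _ (hmem i hi).2).inv
      (hr _ (hmem j hj).1 _ (hmem j hj).2).inv (hr _ (hmem k hk).1 _ (hmem k hk).2).inv
      (inv i j hji) (inv i k hki) (by simpa only [len_inv] using h2)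
      (by simpa only [len_inv] using h1) (by simpa only [len_inv] using (hl _ (hmem k hk).1).1)
      (by simpa only [len_inv] using (hl _ (hmem i hi).1).2) ht' ?_
    · rwa [inv_inv, show b * (b⁻¹ * t⁻¹ * b) * b⁻¹ = t⁻¹ by group] at this
    · intro t' τ' h0 h
      have := h.inv.conj b
      rw [smul_inv_smul] at this
      exact hmin _ _ h0 this
  set RV := U.filter (fun u => T.BeginsPeriodic o u (b⁻¹ * t * b) τ) with hRV
  set RU := U.filter (fun u => T.BeginsPeriodic o u⁻¹ t⁻¹ τ) with hRU
  have c1 : (P.filter QV).card ≤ U.card * RV.card := by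
    rw [← Finset.card_product]
    refine Finset.card_le_card fun i hi => ?_
    have hiP := (Finset.mem_filter.mp hi).1
    exact Finset.mem_product.mpr ⟨(hmem i hiP).1, Finset.mem_filter.mpr ⟨(hmem i hiP).2, hV i hi⟩⟩
  have c2 : (P.filter QU).card ≤ U.card * RU.card := by
    rw [mul_comm, ← Finset.card_product]
    refine Finset.card_le_card fun i hi => ?_
    have hiP := (Finset.mem_filter.mp hi).1
    exact Finset.mem_product.mpr ⟨Finset.mem_filter.mpr ⟨(hmem i hiP).1, hU i hi⟩, (hmem i hiP).2⟩
  rw [hPc] at cU cV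
  -- each condition holds for more than seven eighths of `U`, so both hold for three quarters of it
  have d1 := seven_mul_lt_eight_mul cV hcard c1
  have d2 := seven_mul_lt_eight_mul cU hcard c2
  have d3 := Finset.card_union_add_card_inter RV RU
  have d5 : RV ∩ RU = U.filter (fun u => T.BeginsPeriodic o u (b⁻¹ * t * b) τ ∧
      T.BeginsPeriodic o u⁻¹ t⁻¹ τ) := by rw [hRV, hRU, ← Finset.filter_and]
  have d4 : (RV ∪ RU).card ≤ U.card := Finset.card_le_card
    (Finset.union_subset (Finset.filter_subset _ _) (Finset.filter_subset _ _))
  rw [d5] at d3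
  clear cU cV c1 c2 hU hV hmin hkey hinjU hinjV hred
  omega

open Classical in
/-- Suppose that all products `u b u'` and `b u b'` with factors alternately in `U` and `B` are
reduced and that the elements of `B` are at least as long as those of `U`. If there are few
products of each of the two kinds, then a large part of `B` lies in a coset of the stabiliser of
the axis of some hyperbolic element `t`. -/
theorem exists_axis_coset {U B : Finset Γ} {N : ℕ}
    (hr : ∀ u ∈ U, ∀ b ∈ B, ∀ u' ∈ U, T.Reduced o u b u')
    (hr' : ∀ b ∈ B, ∀ u ∈ U, ∀ b' ∈ B, T.Reduced o b u b')
    (hl : ∀ u ∈ U, ∀ b ∈ B, 0 < T.len o u ∧ T.len o u ≤ T.len o b)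
    (hN : ∀ b ∈ B, ((U ×ˢ U).image (fun p => p.1 * b * p.2)).card ≤ N)
    (hN' : ∀ u ∈ U, ((B ×ˢ B).image (fun p => p.1 * u * p.2)).card ≤ N)
    (hU : 16 * N < U.card ^ 2) (hB : 16 * N < B.card ^ 2) :
    ∃ S ⊆ B, 5 * B.card ≤ 12 * S.card ∧ ∃ t y, T.Hyp t ∧
      ∀ v ∈ S, Commute ((y⁻¹ * v) * t * (y⁻¹ * v)⁻¹) t := by
  have hper : ∀ b, ∃ (t : Γ) (τ : ℕ), b ∈ B → 0 < τ ∧ T.IsShift t o (b • o) τ ∧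
      3 * U.card ≤ 4 * (U.filter (fun u => T.BeginsPeriodic o u (b⁻¹ * t * b) τ ∧
        T.BeginsPeriodic o u⁻¹ t⁻¹ τ)).card := by
    intro b
    by_cases hb : b ∈ B
    · obtain ⟨t, τ, h⟩ := exists_period (fun u hu v hv => hr u hu b hb v hv)
        (fun u hu => hl u hu b hb) (by have := hN b hb; omega)
      exact ⟨t, τ, fun _ => h⟩
    · exact ⟨1, 0, fun h => (hb h).elim⟩
  choose t τ hper using hper
  have hUne : U.Nonempty := by
    rw [← Finset.card_pos]
    by_contra h
    have : U.card = 0 := by omega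
    rw [this] at hU
    omega
  -- an element `u` which has the right ends for most of `B`
  obtain ⟨u, hu, huc⟩ : ∃ u ∈ U, 3 * B.card ≤ 4 * (B.filter (fun b =>
      T.BeginsPeriodic o u (b⁻¹ * t b * b) (τ b) ∧ T.BeginsPeriodic o u⁻¹ (t b)⁻¹ (τ b))).card := by
    refine exists_mul_card_le_filter (A := B) (B := U) (c := 3) (e := 4)
      (fun b u => T.BeginsPeriodic o u (b⁻¹ * t b * b) (τ b) ∧
        T.BeginsPeriodic o u⁻¹ (t b)⁻¹ (τ b)) hUne ?_
    rw [Finset.mul_sum, ← mul_assoc, mul_comm 3, mul_assoc, ← smul_eq_mul]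
    exact Finset.card_nsmul_le_sum _ _ _ fun b hb => (hper b hb).2.2
  set B' := B.filter (fun b => T.BeginsPeriodic o u (b⁻¹ * t b * b) (τ b) ∧
    T.BeginsPeriodic o u⁻¹ (t b)⁻¹ (τ b)) with hB'
  have hmemB : ∀ b ∈ B', b ∈ B := fun b hb => (Finset.mem_filter.mp hb).1
  have hshift : ∀ b ∈ B', T.IsShift (b⁻¹ * t b * b) (b⁻¹ • o) o (τ b) := by
    intro b hb
    have := (hper b (hmemB b hb)).2.1.conj b⁻¹
    rwa [inv_inv, inv_smul_smul] at this
  have hypt : ∀ b ∈ B', T.Hyp (t b) := fun b hb =>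
    ⟨_, (hper b (hmemB b hb)).2.1.onAxis (hper b (hmemB b hb)).1⟩
  have hyps : ∀ b ∈ B', T.Hyp (b⁻¹ * t b * b) := fun b hb =>
    ⟨_, (hshift b hb).onAxis (hper b (hmemB b hb)).1⟩
  have hypu : ∀ b ∈ B', T.Hyp (u * t b * u⁻¹) := fun b hb => (hypt b hb).conj u
  -- collisions force commutation relations
  set P := B' ×ˢ B' with hP
  set f : Γ × Γ → Γ := fun p => p.1 * u * p.2 with hf
  have hmem : ∀ p ∈ P, p.1 ∈ B' ∧ p.2 ∈ B' := fun p hp => Finset.mem_product.mp hp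
  have hredP : ∀ p ∈ P, T.Reduced o p.1 u p.2 := fun p hp =>
    hr' _ (hmemB _ (hmem p hp).1) u hu _ (hmemB _ (hmem p hp).2)
  have hinj : ∀ i ∈ P, ∀ j ∈ P, f i = f j → T.len o i.1 = T.len o j.1 → i = j := by
    intro i hi j hj hij hlen
    have h1 := eq_of_collision (hredP i hi) (hredP j hj) hij hlen
      (hl u hu _ (hmemB _ (hmem i hi).1)).1
    refine Prod.ext h1 ?_
    simp only [hf] at hij
    rw [h1] at hij
    exact mul_left_cancel hij
  have hleft : ∀ i ∈ P, ∀ j ∈ P, f i = f j → T.len o i.1 < T.len o j.1 →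
      Commute (i.1⁻¹ * j.1) (j.1⁻¹ * t j.1 * j.1) := by
    intro i hi j hj hij hlt
    have hj1 := (hmem j hj).1
    exact commute_of_collision (hredP i hi) (hredP j hj) hij hlt (hper _ (hmemB _ hj1)).1
      (hshift _ hj1) (Finset.mem_filter.mp hj1).2.1
  have hright : ∀ i ∈ P, ∀ j ∈ P, f i = f j → T.len o i.1 < T.len o j.1 →
      Commute (i.1⁻¹ * j.1) (u * t i.2 * u⁻¹) := by
    intro i hi j hj hij hlt
    have hi2 := (hmem i hi).2
    have hlt2 : T.len o j.2 < T.len o i.2 := by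
      have h1 : T.len o (f i) = _ := hredP i hi
      have h2 : T.len o (f j) = _ := hredP j hj
      rw [hij] at h1
      omega
    have hinv : j.2⁻¹ * u⁻¹ * j.1⁻¹ = i.2⁻¹ * u⁻¹ * i.1⁻¹ := by
      have : (f i)⁻¹ = (f j)⁻¹ := by rw [hij]
      simpa [hf, mul_assoc] using this.symm
    have h := commute_of_collision (s := (t i.2)⁻¹) (τ := τ i.2) (hredP j hj).inv (hredP i hi).inv
      hinv (by simpa only [len_inv] using hlt2) (hper _ (hmemB _ hi2)).1
      (by rw [inv_inv]; exact (hper _ (hmemB _ hi2)).2.1.inv) (Finset.mem_filter.mp hi2).2.2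
    rw [inv_inv, Commute.inv_right_iff] at h
    have h2 := (Commute.conj_iff u).mpr h
    have e : u * (j.2 * i.2⁻¹) * u⁻¹ = (i.1⁻¹ * j.1)⁻¹ := by
      have : j.1⁻¹ * (i.1 * u * i.2) * i.2⁻¹ = j.1⁻¹ * (j.1 * u * j.2) * i.2⁻¹ := by
        rw [show i.1 * u * i.2 = j.1 * u * j.2 from hij]
      have h3 : j.1⁻¹ * i.1 * u = u * j.2 * i.2⁻¹ := by
        simpa [mul_assoc] using this
      rw [← mul_assoc, ← h3]
      group
    rw [e, Commute.inv_left_iff] at h2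
    exact h2
  -- The middle pairs of the fibres are related by `R`. Three collisions `j`, `i`, `k` give three
  -- quotients of left factors which commute with each other and with both translations.
  set R : Γ → Γ → Prop := fun v w => Commute (v⁻¹ * t v * v) (u * t w * u⁻¹) with hR
  have hRmid : ∀ i ∈ P, (∃ j ∈ P, ∃ k ∈ P, f j = f i ∧ f k = f i ∧ T.len o j.1 < T.len o i.1 ∧
      T.len o i.1 < T.len o k.1) → R i.1 i.2 := by
    rintro i hi ⟨j, hj, k, hk, hji, hki, h1, h2⟩
    have c1 := hleft j hj i hi hji h1
    have c2 := hleft i hi k hk hki.symm h2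
    have c3 := hleft j hj k hk (hji.trans hki.symm) (h1.trans h2)
    have c4 := hright i hi k hk hki.symm h2
    have hne1 : j.1⁻¹ * i.1 ≠ 1 := by
      intro h
      rw [inv_mul_eq_one.mp h] at h1
      omega
    have hne2 : i.1⁻¹ * k.1 ≠ 1 := by
      intro h
      rw [inv_mul_eq_one.mp h] at h2
      omega
    have hy1 := (hyps _ (hmem i hi).1).of_commute c1 hne1
    have hy2 := (hyps _ (hmem k hk).1).of_commute c2 hne2
    have c5 : Commute (i.1⁻¹ * k.1) (j.1⁻¹ * i.1) := by
      have := (hyps _ (hmem k hk).1).commute c2 c3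
      have := this.mul_right (Commute.refl (i.1⁻¹ * k.1)).inv_right
      rwa [show j.1⁻¹ * k.1 * (i.1⁻¹ * k.1)⁻¹ = j.1⁻¹ * i.1 by group] at this
    have c6 := hy1.commute c1.symm c5
    exact hy2.commute c6 c4.symm
  have cM : P.card ≤ (P.filter (fun p => R p.1 p.2)).card + 2 * (P.image f).card :=
    card_le_card_filter_between_add hinj fun i hi j hj k hk h1 h2 h3 h4 =>
      hRmid i hi ⟨j, hj, k, hk, h1, h2, h3, h4⟩
  have hPc : P.card = B'.card ^ 2 := by rw [hP, Finset.card_product, sq]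
  have himg : (P.image f).card ≤ N :=
    (Finset.card_le_card (Finset.image_subset_image (Finset.product_subset_product
      (Finset.filter_subset _ _) (Finset.filter_subset _ _)))).trans (hN' u hu)
  -- `9 = 16 * (3 / 4) ^ 2`
  have h9 : 9 * N < B'.card ^ 2 := by nlinarith
  have hBne : B'.Nonempty := by
    rw [← Finset.card_pos]
    by_contra h
    have : B'.card = 0 := by omega
    rw [this] at h9
    omega
  have hRc : 7 * (B'.card * B'.card) ≤ 9 * ((B' ×ˢ B').filter (fun p => R p.1 p.2)).card := by
    rw [← sq, ← hP]
    omega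
  -- the elements related both to a popular right factor `w` and to a popular left factor `v₀` make
  -- up five ninths of `B'`, since `2 * (7 / 9) - 1 = 5 / 9`
  obtain ⟨w, hw, hwc⟩ := exists_mul_card_le_filter (A := B') (B := B') R hBne
    (c := 7) (e := 9) (by rw [sum_card_filter_eq]; exact hRc)
  obtain ⟨v₀, hv₀, hvc⟩ := exists_mul_card_le_filter (A := B') (B := B') (fun w v => R v w) hBne
    (c := 7) (e := 9) (by
      have e : ∑ w ∈ B', (B'.filter (fun v => R v w)).card = ∑ v ∈ B', (B'.filter (R v)).card :=
        (Finset.sum_card_bipartiteAbove_eq_sum_card_bipartiteBelow R).symm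
      rw [e, sum_card_filter_eq]
      exact hRc)
  set S := B'.filter (fun v => R v w ∧ R v₀ v) with hS
  have hSc : 5 * B'.card ≤ 9 * S.card := by
    have d3 := Finset.card_union_add_card_inter (B'.filter (fun v => R v w))
      (B'.filter (fun v => R v₀ v))
    have d4 : (B'.filter (fun v => R v w) ∪ B'.filter (fun v => R v₀ v)).card ≤ B'.card :=
      Finset.card_le_card (Finset.union_subset (Finset.filter_subset _ _)
        (Finset.filter_subset _ _))
    rw [← Finset.filter_and, ← hS] at d3
    omega
  have hBpos := Finset.card_pos.mpr hBne
  obtain ⟨y, hy⟩ : S.Nonempty := Finset.card_pos.mp (by omega)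
  refine ⟨S, (Finset.filter_subset _ _).trans (Finset.filter_subset _ _), by omega,
    y⁻¹ * t y * y, y, hyps y (Finset.mem_filter.mp hy).1, ?_⟩
  intro v hv
  obtain ⟨hvB, hv1, hv2⟩ := Finset.mem_filter.mp hv
  obtain ⟨hyB, hy1, hy2⟩ := Finset.mem_filter.mp hy
  -- `w` shows that `y⁻¹ t_y y` and `v⁻¹ t_v v` commute, `v₀` that `t_v` and `t_y` commute
  have c1 : Commute (y⁻¹ * t y * y) (v⁻¹ * t v * v) := (hypu w hw).commute hy1 hv1
  have c2 : Commute (t v) (t y) :=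
    (Commute.conj_iff u).mp ((hyps v₀ hv₀).commute (Commute.symm hv2) (Commute.symm hy2))
  have c3 : Commute (v * (y⁻¹ * t y * y) * v⁻¹) (t v) := by
    have := (Commute.conj_iff v).mpr c1
    rwa [show v * (v⁻¹ * t v * v) * v⁻¹ = t v by group] at this
  have c4 := (hypt v hvB).commute c3 c2.symm
  have c5 := (Commute.conj_iff y⁻¹).mpr c4
  rw [inv_inv] at c5
  rwa [show y⁻¹ * v * (y⁻¹ * t y * y) * (y⁻¹ * v)⁻¹ =
    y⁻¹ * (v * (y⁻¹ * t y * y) * v⁻¹) * y by group]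

end TreeAction

/-! ### The stabiliser of an axis -/

/-- The elements conjugating `t` to itself or to its inverse. For a hyperbolic automorphism `t` of
a tree this is the stabiliser of the axis of `t`. -/
def axisStab {Γ : Type*} [Group Γ] (t : Γ) : Subgroup Γ where
  carrier := {x | x * t * x⁻¹ = t ∨ x * t * x⁻¹ = t⁻¹}
  one_mem' := by simp
  mul_mem' := by
    intro x y hx hy
    have e : x * y * t * (x * y)⁻¹ = x * (y * t * y⁻¹) * x⁻¹ := by group
    have i : x * t⁻¹ * x⁻¹ = (x * t * x⁻¹)⁻¹ := by group
    simp only [Set.mem_ofPred_eq] at hx hy ⊢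
    rw [e]
    rcases hy with hy | hy <;> rcases hx with hx | hx <;> simp [hy, i, hx]
  inv_mem' := by
    intro x hx
    simp only [Set.mem_ofPred_eq] at hx ⊢
    rcases hx with hx | hx
    · left
      rw [mul_inv_eq_iff_eq_mul] at hx
      rw [inv_inv, mul_assoc, ← hx]; group
    · right
      have h2 : x * t⁻¹ = t * x := by
        rw [mul_inv_eq_iff_eq_mul] at hx
        have : x * t⁻¹ = t * (t⁻¹ * x) * t⁻¹ := by group
        rw [this, ← hx]; group
      rw [inv_inv, mul_assoc, ← h2]; group

lemma commute_iff_conj_eq {Γ : Type*} [Group Γ] {t x : Γ} : Commute x t ↔ x * t * x⁻¹ = t := by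
  rw [mul_inv_eq_iff_eq_mul]; rfl

/-- The quotient of two elements of `axisStab t` acting in the same way on `t` commutes
with `t`. -/
lemma commute_of_mem_axisStab {Γ : Type*} [Group Γ] {t x y : Γ} (hx : x ∈ axisStab t)
    (hy : y ∈ axisStab t) (h : Commute x t ↔ Commute y t) : Commute (x⁻¹ * y) t := by
  by_cases hxt : Commute x t
  · exact hxt.inv_left.mul_left (h.mp hxt)
  · have hyt := fun h' => hxt (h.mpr h')
    rw [commute_iff_conj_eq] at hxt hyt
    have h1 := hx.resolve_left hxt
    have h2 := hy.resolve_left hyt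
    rw [commute_iff_conj_eq]
    have e : x⁻¹ * y * t * (x⁻¹ * y)⁻¹ = x⁻¹ * (y * t * y⁻¹) * x := by group
    rw [e, h2, ← h1]
    group

namespace TreeAction

variable {Γ V : Type*} [Group Γ] [MulAction Γ V] {T : TreeAction Γ V} {t x : Γ}

lemma Hyp.mem_axisStab (ht : T.Hyp t) (hx : Commute (x * t * x⁻¹) t) : x ∈ axisStab t :=
  ht.conj_eq hx

lemma Hyp.sq_ne_one (ht : T.Hyp t) : t * t ≠ 1 := by
  obtain ⟨p, h1, h2⟩ := ht
  intro h
  rw [← mul_smul, h, one_smul, T.d_self] at h2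
  omega

/-- An element reversing the axis is an involution: its square would be a translation of the axis
commuting with it. -/
lemma Hyp.sq_eq_one (ht : T.Hyp t) (hx : x ∈ axisStab t) (hxt : ¬ Commute x t) : x * x = 1 := by
  by_contra hne
  have h1 := hx.resolve_left (fun h => hxt (commute_iff_conj_eq.mpr h))
  have hc : Commute (x * x) t := by
    rw [commute_iff_conj_eq]
    have e : x * x * t * (x * x)⁻¹ = x * (x * t * x⁻¹) * x⁻¹ := by group
    have i : x * t⁻¹ * x⁻¹ = (x * t * x⁻¹)⁻¹ := by group
    rw [e, h1, i, h1, inv_inv]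
  have hh := ht.of_commute hc hne
  exact hxt (hh.commute ((Commute.refl x).mul_right (Commute.refl x)) hc.symm)

lemma Hyp.commute_of_hyp (ht : T.Hyp t) (hx : x ∈ axisStab t) (hh : T.Hyp x) : Commute x t := by
  by_contra h
  exact hh.sq_ne_one (ht.sq_eq_one hx h)

/-- If a conjugation moves a hyperbolic element commuting with `t` into `axisStab t`, then it
stabilises the axis of `t`. -/
lemma Hyp.mem_axisStab_of_conj {g : Γ} (ht : T.Hyp t) (hg : Commute g t) (h1 : g ≠ 1)
    (hx : x * g * x⁻¹ ∈ axisStab t) : x ∈ axisStab t := by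
  have hhg := ht.of_commute hg h1
  have hc := ht.commute_of_hyp hx (hhg.conj x)
  exact ht.mem_axisStab ((hhg.conj x).commute ((Commute.conj_iff x).mpr hg).symm hc.symm)

open Classical in
/-- A finite set with few triple products which has a large part in a coset of the stabiliser of
an axis is contained in this stabiliser: the intersection of this stabiliser with a different
conjugate of it contains no translations, so that otherwise each product `s c s'` would arise
from at most two pairs. -/
lemma subset_axisStab {A S : Finset Γ} {N : ℕ} {y : Γ} (ht : T.Hyp t) (hSA : S ⊆ A)
    (hS : ∀ v ∈ S, Commute ((y⁻¹ * v) * t * (y⁻¹ * v)⁻¹) t)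
    (hA : ∀ c ∈ A, ((S ×ˢ S).image (fun p => p.1 * c * p.2)).card ≤ N)
    (hN : 2 * N < S.card ^ 2) (hAN : A.card ≤ N) : ∀ c ∈ A, c ∈ axisStab t := by
  have hSE : ∀ v ∈ S, y⁻¹ * v ∈ axisStab t := fun v hv => ht.mem_axisStab (hS v hv)
  -- otherwise an element of the set of products comes from at most two pairs
  have step : ∀ c ∈ A, c * y ∈ axisStab t := by
    intro c hc
    by_contra hcy
    let σ : Γ → Bool := fun v => decide (Commute (y⁻¹ * v) t)
    have hinj : Set.InjOn (fun p : Γ × Γ => (p.1 * c * p.2, σ p.1)) (S ×ˢ S : Finset (Γ × Γ)) := by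
      intro p hp q hq hpq
      obtain ⟨hp1, hp2⟩ := Finset.mem_product.mp hp
      obtain ⟨hq1, hq2⟩ := Finset.mem_product.mp hq
      simp only [Prod.mk.injEq, σ, decide_eq_decide] at hpq
      obtain ⟨h1, h2⟩ := hpq
      have hg := commute_of_mem_axisStab (hSE _ hp1) (hSE _ hq1) h2
      have hg1 : (y⁻¹ * p.1)⁻¹ * (y⁻¹ * q.1) = 1 := by
        by_contra hne
        refine hcy (inv_inv (c * y) ▸ (axisStab t).inv_mem ?_)
        refine ht.mem_axisStab_of_conj hg hne ?_
        have e : (c * y)⁻¹ * ((y⁻¹ * p.1)⁻¹ * (y⁻¹ * q.1)) * ((c * y)⁻¹)⁻¹ =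
            (y⁻¹ * p.2) * (y⁻¹ * q.2)⁻¹ := by
          have : p.1⁻¹ * q.1 * c = c * p.2 * q.2⁻¹ := by
            have : p.1⁻¹ * (p.1 * c * p.2) * q.2⁻¹ = p.1⁻¹ * (q.1 * c * q.2) * q.2⁻¹ := by rw [h1]
            simpa [mul_assoc] using this.symm
          calc _ = y⁻¹ * c⁻¹ * (p.1⁻¹ * q.1 * c) * y := by group
            _ = _ := by rw [this]; group
        rw [e]
        exact (axisStab t).mul_mem (hSE _ hp2) ((axisStab t).inv_mem (hSE _ hq2))
      have hpq1 : p.1 = q.1 := mul_left_cancel (inv_mul_eq_one.mp hg1)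
      refine Prod.ext hpq1 ?_
      rw [hpq1] at h1
      exact mul_left_cancel h1
    have h1 := Finset.card_le_card_of_injOn (t := (S ×ˢ S).image (fun p => p.1 * c * p.2) ×ˢ
      (Finset.univ : Finset Bool)) _ (fun p hp => Finset.mem_product.mpr
        ⟨Finset.mem_image_of_mem _ hp, Finset.mem_univ _⟩) hinj
    rw [Finset.card_product, Finset.card_product, Finset.card_univ, Fintype.card_bool, ← sq] at h1
    have := hA c hc
    omega
  -- two of three elements of `S` act in the same way on `t`
  have hS3 : 2 < S.card := by
    have h1 := Finset.card_le_card hSA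
    by_contra h
    have h2 : S.card ^ 2 ≤ 2 * S.card := by
      rw [sq]
      exact Nat.mul_le_mul_right _ (by omega)
    omega
  have hyE : y ∈ axisStab t := by
    obtain ⟨v, hv, w, hw, hne, hvw⟩ := Finset.exists_ne_map_eq_of_card_lt_of_maps_to
      (s := S) (t := (Finset.univ : Finset Bool)) (by simpa using hS3)
      (f := fun v => decide (Commute (y⁻¹ * v)⁻¹ t)) (fun _ _ => Finset.mem_univ _)
    simp only [decide_eq_decide] at hvw
    have hg := commute_of_mem_axisStab ((axisStab t).inv_mem (hSE v hv))
      ((axisStab t).inv_mem (hSE w hw)) hvw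
    refine ht.mem_axisStab_of_conj hg ?_ ?_
    · intro h
      apply hne
      have := inv_mul_eq_one.mp h
      exact mul_left_cancel (inv_injective this)
    · have e : y * (((y⁻¹ * v)⁻¹)⁻¹ * (y⁻¹ * w)⁻¹) * y⁻¹ = (v * y) * (w * y)⁻¹ := by group
      rw [e]
      exact (axisStab t).mul_mem (step v (hSA hv)) ((axisStab t).inv_mem (step w (hSA hw)))
  intro c hc
  have := (axisStab t).mul_mem (step c hc) ((axisStab t).inv_mem hyE)
  rwa [mul_inv_cancel_right] at this

open Classical in
/-- A finite set with few triple products which has a large part in the stabiliser of a vertex is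
contained in this stabiliser. -/
lemma subset_stabilizer (T : TreeAction Γ V) {A S : Finset Γ} {N : ℕ} {o : V}
    (hS : ∀ v ∈ S, v • o = o)
    (hA : ∀ c ∈ A, ((S ×ˢ S).image (fun p => p.1 * c * p.2)).card ≤ N)
    (hN : N < S.card ^ 2) : ∀ c ∈ A, c • o = o := by
  intro c hc
  by_contra hco
  have hinj : Set.InjOn (fun p : Γ × Γ => p.1 * c * p.2) (S ×ˢ S : Finset (Γ × Γ)) := by
    intro p hp q hq hpq
    obtain ⟨hp1, hp2⟩ := Finset.mem_product.mp hp
    obtain ⟨hq1, hq2⟩ := Finset.mem_product.mp hq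
    have fixinv : ∀ v ∈ S, v⁻¹ • o = o := fun v hv => by rw [inv_smul_eq_iff, hS v hv]
    have h1 : p.1⁻¹ * q.1 = 1 := by
      refine T.free _ (x := o) (y := c • o) ?_ ?_ (fun h => hco h.symm)
      · rw [mul_smul, hS _ hq1, fixinv _ hp1]
      · have : p.1⁻¹ * q.1 * c = c * p.2 * q.2⁻¹ := by
          have : p.1⁻¹ * (p.1 * c * p.2) * q.2⁻¹ = p.1⁻¹ * (q.1 * c * q.2) * q.2⁻¹ :=
            congrArg (fun z => p.1⁻¹ * z * q.2⁻¹) hpq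
          simpa [mul_assoc] using this.symm
        rw [← mul_smul, this, mul_smul, mul_smul, fixinv _ hq2, hS _ hp2]
    have hpq1 := inv_mul_eq_one.mp h1
    refine Prod.ext hpq1 ?_
    simp only [hpq1] at hpq
    exact mul_left_cancel hpq
  have h1 := Finset.card_image_of_injOn hinj
  rw [Finset.card_product, ← sq] at h1
  have := hA c hc
  omega

end TreeAction

/-! ### Recognising infinite cyclic and infinite dihedral groups -/

/-- A group with an element `c` of infinite order and an involution `x` inverting `c`, such that
the powers of `c` have index two, is infinite dihedral. -/
lemma isInfiniteDihedral_of_involution {K : Type*} [Group K] {x c : K} (hx : x * x = 1)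
    (hxc : x * c * x⁻¹ = c⁻¹) (hc : Function.Injective (fun n : ℤ => c ^ n))
    (hxz : x ∉ Subgroup.zpowers c)
    (hK : ∀ k, k ∈ Subgroup.zpowers c ∨ x⁻¹ * k ∈ Subgroup.zpowers c) : IsInfiniteDihedral K := by
  have hz : ∀ n : ℤ, c ^ n * x = x * c ^ (-n) := by
    intro n
    have h1 : x * c ^ (-n) * x⁻¹ = c ^ n := by
      rw [← conj_zpow, hxc, inv_zpow', neg_neg]
    rw [← h1]; group
  let φ : DihedralGroup 0 → K := fun d => match d with
    | DihedralGroup.r (i : ℤ) => c ^ i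
    | DihedralGroup.sr (i : ℤ) => x * c ^ i
  have hmul : ∀ a b, φ (a * b) = φ a * φ b := by
    rintro ((i : ℤ) | (i : ℤ)) ((j : ℤ) | (j : ℤ))
    · exact zpow_add c i j
    · change x * c ^ (j - i) = c ^ i * (x * c ^ j)
      rw [← mul_assoc, hz, mul_assoc, ← zpow_add]
      congr 2
      exact (neg_add_eq_sub _ _).symm
    · change x * c ^ (i + j) = x * c ^ i * c ^ j
      rw [zpow_add, mul_assoc]
    · change c ^ (j - i) = x * c ^ i * (x * c ^ j)
      rw [← mul_assoc, mul_assoc x (c ^ i) x, hz, ← mul_assoc, hx, one_mul, ← zpow_add]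
      congr 1
      exact (neg_add_eq_sub _ _).symm
  refine ⟨(MulEquiv.ofBijective (MonoidHom.mk' φ hmul) ⟨?_, ?_⟩).symm⟩
  · rw [injective_iff_map_eq_one]
    rintro ((i : ℤ) | (i : ℤ)) h
    · have : c ^ i = c ^ (0 : ℤ) := by rw [zpow_zero]; exact h
      exact congrArg DihedralGroup.r (hc this)
    · exfalso
      apply hxz
      have : x * c ^ i = 1 := h
      rw [mul_eq_one_iff_eq_inv.mp this]
      exact (Subgroup.zpowers c).inv_mem (Subgroup.zpow_mem_zpowers c _)
  · intro k
    rcases hK k with ⟨n, hn⟩ | ⟨n, hn⟩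
    · exact ⟨DihedralGroup.r (n : ℤ), hn⟩
    · refine ⟨DihedralGroup.sr (n : ℤ), ?_⟩
      change x * c ^ n = k
      have hn' : c ^ n = x⁻¹ * k := hn
      rw [hn', mul_inv_cancel_left]

namespace TreeAction

variable {Γ V : Type*} [Group Γ] [MulAction Γ V] {T : TreeAction Γ V} {t x : Γ}

lemma Hyp.zpow_injective (ht : T.Hyp t) : Function.Injective (fun n : ℤ => t ^ n) := by
  rw [injective_zpow_iff_not_isOfFinOrder, isOfFinOrder_iff_pow_eq_one]
  rintro ⟨n, hn, h⟩
  obtain ⟨p, hp⟩ := ht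
  have h1 := hp.d_pow n
  rw [h, one_smul, T.d_self] at h1
  have := Nat.mul_pos hn hp.1
  omega

/-- The centraliser of a hyperbolic element is cyclic, as it acts on the axis by translations. -/
lemma Hyp.isCyclic {K : Subgroup Γ} (ht : T.Hyp t) (hK : ∀ k ∈ K, Commute k t) : IsCyclic K := by
  obtain ⟨p, hp⟩ := ht
  obtain ⟨f, -, hadd, hinj, -⟩ := hp.exists_translation
  let φ : K →* Multiplicative ℤ := MonoidHom.mk' (fun k => Multiplicative.ofAdd (f k)) fun a b => by
    rw [Subgroup.coe_mul, hadd _ _ (hK _ a.2) (hK _ b.2), ofAdd_add]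
  refine isCyclic_of_injective φ ?_
  rw [injective_iff_map_eq_one]
  intro k hk
  exact Subtype.ext (hinj k (hK _ k.2) hk)

/-- The stabiliser of the axis of a hyperbolic element acts faithfully on the axis, so that its
subgroups are infinite cyclic or infinite dihedral unless they have at most two elements. -/
theorem Hyp.isInfiniteCyclic_or_isInfiniteDihedral {K : Subgroup Γ} (ht : T.Hyp t)
    (hK : K ≤ axisStab t) {S : Finset Γ} (hSK : ∀ v ∈ S, v ∈ K) (hS : 2 < S.card) :
    IsInfiniteCyclic K ∨ IsInfiniteDihedral K := by
  classical
  -- a translation in `K`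
  obtain ⟨g, hgK, hgt, hg1⟩ : ∃ g ∈ K, Commute g t ∧ g ≠ 1 := by
    obtain ⟨v, hv, w, hw, hne, hvw⟩ := Finset.exists_ne_map_eq_of_card_lt_of_maps_to
      (s := S) (t := (Finset.univ : Finset Bool)) (by simpa using hS)
      (f := fun v => decide (Commute v t)) (fun _ _ => Finset.mem_univ _)
    simp only [decide_eq_decide] at hvw
    refine ⟨v⁻¹ * w, K.mul_mem (K.inv_mem (hSK v hv)) (hSK w hw),
      commute_of_mem_axisStab (hK (hSK v hv)) (hK (hSK w hw)) hvw, ?_⟩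
    intro h
    exact hne (inv_mul_eq_one.mp h)
  have hg := ht.of_commute hgt hg1
  by_cases hall : ∀ k ∈ K, Commute k t
  · refine Or.inl ⟨ht.isCyclic hall, Infinite.of_injective (fun n : ℤ => (⟨g, hgK⟩ : K) ^ n) ?_⟩
    intro m n hmn
    exact hg.zpow_injective (by simpa using congrArg (fun k : K => (k : Γ)) hmn)
  · push Not at hall
    obtain ⟨x, hxK, hxt⟩ := hall
    refine Or.inr ?_
    let C : Subgroup Γ := K ⊓ Subgroup.centralizer {t}
    have hC : ∀ k, k ∈ C ↔ k ∈ K ∧ Commute k t := fun k => by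
      simp only [C, Subgroup.mem_inf, Subgroup.mem_centralizer_singleton_iff]
      exact Iff.rfl
    obtain ⟨⟨c, hcC⟩, hc⟩ := (ht.isCyclic (K := C) fun k hk => ((hC k).mp hk).2).exists_generator
    obtain ⟨hcK, hct⟩ := (hC c).mp hcC
    have hgen : ∀ k ∈ K, Commute k t → ∃ n : ℤ, c ^ n = k := by
      intro k hk hkt
      obtain ⟨n, hn⟩ := hc ⟨k, (hC k).mpr ⟨hk, hkt⟩⟩
      exact ⟨n, by simpa using congrArg (fun k : C => (k : Γ)) hn⟩
    have hc1 : c ≠ 1 := by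
      rintro rfl
      obtain ⟨n, hn⟩ := hgen g hgK hgt
      rw [one_zpow] at hn
      exact hg1 hn.symm
    have hhc := ht.of_commute hct hc1
    have hx2 := ht.sq_eq_one (hK hxK) hxt
    have hxc : ¬ Commute (x * c) t := fun h => hxt (by simpa using h.mul_left hct.inv_left)
    have hxc2 := ht.sq_eq_one (hK (K.mul_mem hxK hcK)) hxc
    have hzp : ∀ k : K, k ∈ Subgroup.zpowers (⟨c, hcK⟩ : K) ↔ Commute (k : Γ) t := by
      intro k
      constructor
      · rintro ⟨n, rfl⟩
        simpa using hct.zpow_left n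
      · intro h
        obtain ⟨n, hn⟩ := hgen k k.2 h
        exact ⟨n, Subtype.ext (by simpa using hn)⟩
    refine isInfiniteDihedral_of_involution (x := ⟨x, hxK⟩) (c := ⟨c, hcK⟩) (Subtype.ext hx2)
      (Subtype.ext ?_) ?_ ?_ ?_
    · change x * c * x⁻¹ = c⁻¹
      rw [inv_eq_of_mul_eq_one_left hx2]
      exact eq_inv_of_mul_eq_one_left (by rw [mul_assoc]; exact hxc2)
    · intro m n hmn
      exact hhc.zpow_injective (by simpa using congrArg (fun k : K => (k : Γ)) hmn)
    · rw [hzp]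
      exact hxt
    · intro k
      rw [hzp, hzp]
      by_cases hkt : Commute (k : Γ) t
      · exact Or.inl hkt
      · exact Or.inr (commute_of_mem_axisStab (hK hxK) (hK k.2) (iff_of_false hxt hkt))

end TreeAction

/-! ### Cutting a finite set into large parts -/

section Partition

/-- A median of a function on a finite set. -/
lemma exists_median {ι : Type*} (A : Finset ι) (f : ι → ℕ) :
    ∃ m, A.card ≤ 2 * (A.filter (fun a => f a ≤ m)).card ∧
      A.card ≤ 2 * (A.filter (fun a => m ≤ f a)).card := by
  have hex : ∃ m, A.card ≤ 2 * (A.filter (fun a => f a ≤ m)).card := by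
    refine ⟨A.sup f, ?_⟩
    rw [Finset.filter_true_of_mem fun a ha => Finset.le_sup ha]
    omega
  refine ⟨Nat.find hex, Nat.find_spec hex, ?_⟩
  rcases Nat.eq_zero_or_pos (Nat.find hex) with h0 | hpos
  · rw [Finset.filter_true_of_mem fun a _ => by omega]
    omega
  · have h1 := Nat.find_min hex (Nat.sub_lt hpos one_pos)
    have h2 := Finset.card_filter_add_card_filter_not (s := A)
      (fun a => f a ≤ Nat.find hex - 1)
    have h3 : A.filter (fun a => ¬ f a ≤ Nat.find hex - 1) =
        A.filter (fun a => Nat.find hex ≤ f a) :=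
      Finset.filter_congr fun a _ => by omega
    rw [h3] at h2
    omega

/-- If `s a ≠ r a` for all `a ∈ A`, then a random set `X` separates `s a ∈ X` from `r a ∉ X` with
probability one quarter. -/
lemma exists_separating_set {ι V : Type*} [DecidableEq V] (A : Finset ι) (s r : ι → V)
    (h : ∀ a ∈ A, s a ≠ r a) :
    ∃ X : Finset V, A.card ≤ 4 * (A.filter (fun a => s a ∈ X ∧ r a ∉ X)).card := by
  set D := A.image s ∪ A.image r with hD
  obtain ⟨X, -, hX⟩ := exists_mul_card_le_filter (A := A) (B := D.powerset)
    (fun a X => s a ∈ X ∧ r a ∉ X) (c := 1) (e := 4) ⟨∅, Finset.empty_mem_powerset _⟩ (by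
      rw [one_mul, Finset.mul_sum, ← smul_eq_mul]
      refine Finset.card_nsmul_le_sum _ _ _ fun a ha => ?_
      have hs : s a ∈ D := Finset.mem_union_left _ (Finset.mem_image_of_mem s ha)
      have hle := Finset.card_le_card_of_injOn (s := D.powerset)
        (t := D.powerset.filter (fun X => s a ∈ X ∧ r a ∉ X) ×ˢ
          (Finset.univ : Finset (Bool × Bool)))
        (fun X => ((insert (s a) X).erase (r a), (decide (s a ∈ X), decide (r a ∈ X)))) ?_ ?_
      -- putting `s a` into `X` and `r a` out of `X` is a map with fibres of at most four elements
      · rw [Finset.card_product, Finset.card_univ, Fintype.card_prod, Fintype.card_bool] at hle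
        omega
      · intro X hX
        rw [Finset.mem_coe, Finset.mem_powerset] at hX
        refine Finset.mem_product.mpr ⟨Finset.mem_filter.mpr ⟨?_, ?_, ?_⟩, Finset.mem_univ _⟩
        · rw [Finset.mem_powerset]
          exact (Finset.erase_subset _ _).trans (Finset.insert_subset hs hX)
        · exact Finset.mem_erase.mpr ⟨h a ha, Finset.mem_insert_self _ _⟩
        · exact Finset.notMem_erase _ _
      · intro X _ Y _ hXY
        simp only [Prod.mk.injEq, decide_eq_decide] at hXY
        obtain ⟨h1, h2, h3⟩ := hXY
        ext v
        by_cases hvs : v = s a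
        · rw [hvs]; exact h2
        by_cases hvr : v = r a
        · rw [hvr]; exact h3
        have := Finset.ext_iff.mp h1 v
        simpa [hvs, hvr] using this)
  exact ⟨X, by simpa using hX⟩

/-- A finite set all of whose fibres under `s` are small can be cut into two large parts which are
unions of fibres. -/
lemma exists_balanced_set {ι V : Type*} [DecidableEq V] {A : Finset ι} {s : ι → V} {n : ℕ}
    (hn : 0 < n) (hA : 5 * n ≤ 8 * A.card)
    (h : ∀ e, 2 * (A.filter (fun a => s a = e)).card ≤ n) :
    ∃ X : Finset V, n ≤ 11 * (A.filter (fun a => s a ∈ X)).card ∧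
      n ≤ 11 * (A.filter (fun a => s a ∉ X)).card := by
  by_cases hbig : ∃ e, n ≤ 11 * (A.filter (fun a => s a = e)).card
  · obtain ⟨e, he⟩ := hbig
    refine ⟨{e}, ?_, ?_⟩
    · simpa only [Finset.mem_singleton] using he
    · have h1 := Finset.card_filter_add_card_filter_not (s := A) (fun a => s a = e)
      have h2 := h e
      simp only [Finset.mem_singleton]
      omega
  · push Not at hbig
    -- a smallest set whose preimage is large
    have hex : ∃ k, ∃ X : Finset V, X.card = k ∧ n ≤ 11 * (A.filter (fun a => s a ∈ X)).card := by
      refine ⟨_, A.image s, rfl, ?_⟩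
      rw [Finset.filter_true_of_mem fun a ha => Finset.mem_image_of_mem s ha]
      omega
    classical
    obtain ⟨X, hXc, hX⟩ := Nat.find_spec hex
    refine ⟨X, hX, ?_⟩
    have hXne : X.Nonempty := by
      by_contra hne
      rw [Finset.not_nonempty_iff_eq_empty] at hne
      simp [hne] at hX
      omega
    obtain ⟨e, he⟩ := hXne
    have hmin := Nat.find_min hex (m := (X.erase e).card) (by
      rw [← hXc]; exact Finset.card_erase_lt_of_mem he)
    have h1 : (A.filter (fun a => s a ∈ X)).card ≤ (A.filter (fun a => s a ∈ X.erase e)).card +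
        (A.filter (fun a => s a = e)).card := by
      refine (Finset.card_le_card fun a ha => ?_).trans (Finset.card_union_le _ _)
      obtain ⟨ha, hs⟩ := Finset.mem_filter.mp ha
      by_cases hse : s a = e
      · exact Finset.mem_union_right _ (Finset.mem_filter.mpr ⟨ha, hse⟩)
      · exact Finset.mem_union_left _
          (Finset.mem_filter.mpr ⟨ha, Finset.mem_erase.mpr ⟨hse, hs⟩⟩)
    have h2 : ¬ n ≤ 11 * (A.filter (fun a => s a ∈ X.erase e)).card := fun h =>
      hmin ⟨_, rfl, h⟩
    have h3 := hbig e
    have h4 := Finset.card_filter_add_card_filter_not (s := A) (fun a => s a ∈ X)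
    omega

end Partition

/-! ### The base point -/

namespace TreeAction

variable {Γ V : Type*} [Group Γ] [MulAction Γ V] (T : TreeAction Γ V) {o : V}

/-- Geodesics leaving `o` through different vertices `x'` and `y'` form a geodesic. -/
lemma d_eq_add_of_ne {x y x' y' : V} (hx : T.d o x' = 1) (hx' : T.d x' x + 1 = T.d o x)
    (hy : T.d o y' = 1) (hy' : T.d y' y + 1 = T.d o y) (hne : x' ≠ y') :
    T.d x y = T.d o x + T.d o y := by
  have h0 : T.d x' y' ≠ 0 := fun h => hne (T.eq_of_d h)
  obtain ⟨k, hk⟩ := T.even x' o y'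
  have c1 := T.comm x' o
  have c2 := T.comm y' x'
  have c3 := T.comm y y'
  have c4 := T.comm y x'
  have c5 := T.comm y o
  have c6 := T.comm y x
  have f1 := T.four o y x' y'
  have f2 := T.four x' y o x
  have t := T.tri x o y
  have c7 := T.comm x o
  have t2 := T.tri x' o y'
  omega

/-- Reducedness of a product with a middle factor moving `o` is a local condition. -/
lemma reduced_of_len {a b c : Γ} (h1 : T.len o (a * b) = T.len o a + T.len o b)
    (h2 : T.len o (b * c) = T.len o b + T.len o c) (hb : 0 < T.len o b) : T.Reduced o a b c := by
  have f := T.four o ((a * b) • o) (a • o) ((a * b * c) • o)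
  have e : ∀ g : Γ, T.d o (g • o) = T.len o g := fun _ => rfl
  have e1 : a⁻¹ * (a * b * c) = b * c := by group
  have e2 : (a * b)⁻¹ * a = b⁻¹ := by group
  rw [d_smul_smul, d_smul_smul, d_smul_smul, e, e, e, e1, e2, inv_mul_cancel_left, len_inv] at f
  have t := T.len_mul_le o (a * b) c
  unfold Reduced
  omega

open Classical in
/-- The situation of `exists_axis_coset` occurring within a set with few triple products. -/
lemma exists_axisStab_of_alternating {A U B : Finset Γ} {N : ℕ} (hUA : U ⊆ A) (hBA : B ⊆ A)
    (hN : ∀ c ∈ A, ((A ×ˢ A).image (fun p => p.1 * c * p.2)).card ≤ N) (hAN : A.card ≤ N)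
    (hcard : 7776 * N < A.card ^ 2) (hU : A.card ≤ 22 * U.card) (hB : A.card ≤ 22 * B.card)
    (hlen : ∀ u ∈ U, ∀ b ∈ B, 0 < T.len o u ∧ T.len o u ≤ T.len o b)
    (hUB : ∀ u ∈ U, ∀ b ∈ B, T.len o (u * b) = T.len o u + T.len o b)
    (hBU : ∀ u ∈ U, ∀ b ∈ B, T.len o (b * u) = T.len o b + T.len o u) :
    ∃ t, T.Hyp t ∧ ∀ c ∈ A, c ∈ axisStab t := by
  have mono : ∀ S ⊆ A, ∀ c ∈ A, ((S ×ˢ S).image (fun p => p.1 * c * p.2)).card ≤ N :=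
    fun S hS c hc => (Finset.card_le_card (Finset.image_subset_image
      (Finset.product_subset_product hS hS))).trans (hN c hc)
  -- `16 * 22 ^ 2 = 7744 ≤ 7776`
  have h16 : ∀ k : ℕ, A.card ≤ 22 * k → 16 * N < k ^ 2 := fun k hk => by
    have : A.card ^ 2 ≤ (22 * k) ^ 2 := Nat.pow_le_pow_left hk 2
    rw [mul_pow] at this
    omega
  obtain ⟨S, hSB, hS, t, y, ht, hSt⟩ := T.exists_axis_coset (o := o) (U := U) (B := B) (N := N)
    (fun u hu b hb u' hu' => T.reduced_of_len (hUB u hu b hb) (hBU u' hu' b hb)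
      ((hlen u hu b hb).1.trans_le (hlen u hu b hb).2))
    (fun b hb u hu b' hb' => T.reduced_of_len (hBU u hu b hb) (hUB u hu b' hb') (hlen u hu b hb).1)
    hlen (fun b hb => mono U hUA b (hBA hb)) (fun u hu => mono B hBA u (hUA hu)) (h16 _ hU)
    (h16 _ hB)
  refine ⟨t, ht, subset_axisStab ht (hSB.trans hBA) hSt (mono S (hSB.trans hBA)) ?_ hAN⟩
  -- `5 / 12` of `B` is at least `5 / (12 * 22)` of `A`, and `2 * (264 / 5) ^ 2 ≤ 7776`
  have h5 : 5 * A.card ≤ 264 * S.card := by omega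
  have : (5 * A.card) ^ 2 ≤ (264 * S.card) ^ 2 := Nat.pow_le_pow_left h5 2
  rw [mul_pow, mul_pow] at this
  omega

open Classical in
/-- A finite set with few triple products of a group acting on a tree with trivial edge
stabilisers fixes a vertex or stabilises the axis of a hyperbolic element. -/
theorem exists_fixed_or_exists_axisStab [Nonempty V] {A : Finset Γ} {N : ℕ}
    (hN : ∀ c ∈ A, ((A ×ˢ A).image (fun p => p.1 * c * p.2)).card ≤ N) (hAN : A.card ≤ N)
    (hcard : 7776 * N < A.card ^ 2) :
    (∃ o : V, ∀ c ∈ A, c • o = o) ∨ ∃ t, T.Hyp t ∧ ∀ c ∈ A, c ∈ axisStab t := by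
  -- the base point `o` minimises the total displacement; `s a` and `r a` are the next vertices on
  -- the way from `o` to `a o` and to `a⁻¹ o`
  let F : V → ℕ := fun x => ∑ a ∈ A, T.d x (a • x)
  obtain ⟨o, ho⟩ : ∃ o, ∀ x, F o ≤ F x := ⟨Function.argmin F, fun x => Function.argmin_le F x⟩
  have hnext : ∀ y, ∃ z, y ≠ o → T.d o z = 1 ∧ T.d z y + 1 = T.d o y := by
    intro y
    by_cases hy : y = o
    · exact ⟨o, fun h => (h hy).elim⟩
    · obtain ⟨z, hz⟩ := T.step (Ne.symm hy)
      exact ⟨z, fun _ => hz⟩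
  choose next hnext using hnext
  let s : Γ → V := fun a => next (a • o)
  let r : Γ → V := fun a => next (a⁻¹ • o)
  have hs : ∀ a : Γ, a • o ≠ o → T.d o (s a) = 1 ∧ T.d (s a) (a • o) + 1 = T.len o a :=
    fun a ha => hnext _ ha
  have hr : ∀ a : Γ, a • o ≠ o → T.d o (r a) = 1 ∧ T.d (r a) (a⁻¹ • o) + 1 = T.len o a :=
    fun a ha => by
      rw [← T.len_inv]
      exact hnext _ (fun h => ha (by rw [inv_smul_eq_iff] at h; exact h.symm))
  have hpos : ∀ a : Γ, a • o ≠ o → 0 < T.len o a := fun a ha =>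
    Nat.pos_of_ne_zero fun h => ha (T.eq_of_d h).symm
  have hred : ∀ a b : Γ, a • o ≠ o → b • o ≠ o → r a ≠ s b →
      T.len o (a * b) = T.len o a + T.len o b := by
    intro a b ha hb hab
    have h1 := hr a ha
    have h2 := hs b hb
    have h3 : T.d o (a⁻¹ • o) = T.len o a := T.len_inv o a
    have h4 := T.d_eq_add_of_ne h1.1 (by rw [h3]; exact h1.2) h2.1 h2.2 hab
    rw [d_smul_smul, inv_inv, h3] at h4
    exact h4
  -- moving the base point along an edge shows that at most half of `A` starts and ends there
  have hhalf : ∀ e, 2 * (A.filter (fun a => a • o ≠ o ∧ s a = e ∧ r a = e)).card ≤ A.card := by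
    intro e
    by_cases hemp : (A.filter (fun a => a • o ≠ o ∧ s a = e ∧ r a = e)) = ∅
    · simp [hemp]
    obtain ⟨a₀, ha₀⟩ := Finset.nonempty_iff_ne_empty.mpr hemp
    obtain ⟨-, ha₀, hse, -⟩ := Finset.mem_filter.mp ha₀
    have hoe : T.d o e = 1 := hse ▸ (hs a₀ ha₀).1
    have hterm : ∀ a ∈ A, T.d e (a • e) + (if a • o ≠ o ∧ s a = e ∧ r a = e then 4 else 0) ≤
        T.d o (a • o) + 2 := by
      intro a _
      have e1 : T.d (a • o) (a • e) = 1 := by rw [T.smul, hoe]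
      split_ifs with h
      · obtain ⟨hao, hsa, hra⟩ := h
        obtain ⟨-, h1⟩ := hs a hao
        obtain ⟨-, h2⟩ := hr a hao
        rw [hsa] at h1
        rw [hra, T.comm, T.d_inv_smul] at h2
        have h3 := hpos a hao
        obtain ⟨k, hk⟩ := T.even_smul a o
        have h4 : T.len o a = T.d o (a • o) := rfl
        have c := T.comm (a • o) (a • e)
        have := T.d_of_between (P := o) (Q := a • o) (x := e) (y := a • e) (by omega) (by omega)
          (by omega)
        omega
      · have t1 := T.tri e o (a • e)
        have t2 := T.tri o (a • o) (a • e)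
        have c := T.comm e o
        omega
    have hsum := Finset.sum_le_sum hterm
    rw [Finset.sum_add_distrib, Finset.sum_add_distrib, ← Finset.sum_filter, Finset.sum_const,
      Finset.sum_const, smul_eq_mul, smul_eq_mul] at hsum
    have := ho e
    simp only [F] at this
    omega
  have hApos : 0 < A.card := by
    by_contra h
    have : A.card = 0 := by omega
    rw [this] at hcard
    omega
  -- the elements of `A` fixing `o`
  set A₀ := A.filter (fun a => a • o = o) with hA₀
  by_cases hA₀c : N < A₀.card ^ 2
  · refine Or.inl ⟨o, T.subset_stabilizer (S := A₀) (fun v hv => (Finset.mem_filter.mp hv).2)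
      (fun c hc => (Finset.card_le_card (Finset.image_subset_image (Finset.product_subset_product
        (Finset.filter_subset _ _) (Finset.filter_subset _ _)))).trans (hN c hc)) hA₀c⟩
  right
  -- `88 ^ 2 = 7744 ≤ 7776`
  have h88 : 88 * A₀.card < A.card := by
    by_contra h
    have : A.card ^ 2 ≤ (88 * A₀.card) ^ 2 := Nat.pow_le_pow_left (by omega) 2
    rw [mul_pow] at this
    omega
  set A₁ := A.filter (fun a => a • o ≠ o ∧ s a ≠ r a) with hA₁
  set A₂ := A.filter (fun a => a • o ≠ o ∧ s a = r a) with hA₂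
  have hsum : A₀.card + A₁.card + A₂.card = A.card := by
    have h1 := Finset.card_filter_add_card_filter_not (s := A) (fun a => a • o = o)
    have h2 := Finset.card_filter_add_card_filter_not (s := A.filter (fun a => ¬ a • o = o))
      (fun a => s a = r a)
    rw [Finset.filter_filter, Finset.filter_filter] at h2
    rw [hA₀, hA₁, hA₂]
    simp only [ne_eq]
    omega
  by_cases hcase : 4 * A.card ≤ 11 * A₁.card
  · -- at least `4 / 11` of `A` start and end with different edges; a quarter of these can be
    -- separated, and either side of the median then contains `1 / 22` of `A`
    obtain ⟨X, hX⟩ := exists_separating_set A₁ s r fun a ha => (Finset.mem_filter.mp ha).2.2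
    set A' := A₁.filter (fun a => s a ∈ X ∧ r a ∉ X) with hA'
    have hA'A : A' ⊆ A := (Finset.filter_subset _ _).trans (Finset.filter_subset _ _)
    have hmove : ∀ a ∈ A', a • o ≠ o := fun a ha =>
      (Finset.mem_filter.mp (Finset.mem_filter.mp ha).1).2.1
    have hadd : ∀ a ∈ A', ∀ b ∈ A', T.len o (a * b) = T.len o a + T.len o b := by
      intro a ha b hb
      refine hred a b (hmove a ha) (hmove b hb) fun h => ?_
      exact (Finset.mem_filter.mp ha).2.2 (h ▸ (Finset.mem_filter.mp hb).2.1)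
    obtain ⟨m, hm1, hm2⟩ := exists_median A' (T.len o)
    refine T.exists_axisStab_of_alternating (o := o) (U := A'.filter (fun a => T.len o a ≤ m))
      (B := A'.filter (fun a => m ≤ T.len o a)) ((Finset.filter_subset _ _).trans hA'A)
      ((Finset.filter_subset _ _).trans hA'A) hN hAN hcard (by omega) (by omega) ?_ ?_ ?_
    · intro u hu b hb
      have h1 := Finset.mem_filter.mp hu
      have h2 := Finset.mem_filter.mp hb
      exact ⟨hpos u (hmove u h1.1), h1.2.trans h2.2⟩
    · exact fun u hu b hb => hadd u (Finset.mem_filter.mp hu).1 b (Finset.mem_filter.mp hb).1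
    · exact fun u hu b hb => hadd b (Finset.mem_filter.mp hb).1 u (Finset.mem_filter.mp hu).1
  · -- at least `1 - 1 / 88 - 4 / 11 = 5 / 8` of `A` start and end with the same edge
    obtain ⟨X, hX1, hX2⟩ := exists_balanced_set (A := A₂) (s := s) hApos (by omega) (by
      intro e
      refine le_trans ?_ (hhalf e)
      refine Nat.mul_le_mul_left 2 (Finset.card_le_card fun a ha => ?_)
      obtain ⟨ha, hse⟩ := Finset.mem_filter.mp ha
      obtain ⟨ha, hao, hsr⟩ := Finset.mem_filter.mp ha
      exact Finset.mem_filter.mpr ⟨ha, hao, hse, hsr ▸ hse⟩)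
    set AX := A₂.filter (fun a => s a ∈ X) with hAX
    set AY := A₂.filter (fun a => s a ∉ X) with hAY
    have hAXA : AX ⊆ A := (Finset.filter_subset _ _).trans (Finset.filter_subset _ _)
    have hAYA : AY ⊆ A := (Finset.filter_subset _ _).trans (Finset.filter_subset _ _)
    have hX : ∀ a ∈ AX, a • o ≠ o ∧ s a = r a ∧ s a ∈ X := fun a ha => by
      obtain ⟨ha, hs⟩ := Finset.mem_filter.mp ha
      obtain ⟨ha, hao, hsr⟩ := Finset.mem_filter.mp ha
      exact ⟨hao, hsr, hs⟩
    have hY : ∀ a ∈ AY, a • o ≠ o ∧ s a = r a ∧ s a ∉ X := fun a ha => by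
      obtain ⟨ha, hs⟩ := Finset.mem_filter.mp ha
      obtain ⟨ha, hao, hsr⟩ := Finset.mem_filter.mp ha
      exact ⟨hao, hsr, hs⟩
    have hXY : ∀ a ∈ AX, ∀ b ∈ AY, T.len o (a * b) = T.len o a + T.len o b := by
      intro a ha b hb
      obtain ⟨ha, hsa, haX⟩ := hX a ha
      obtain ⟨hb, hsb, hbX⟩ := hY b hb
      exact hred a b ha hb fun h => hbX (h ▸ hsa ▸ haX)
    have hYX : ∀ a ∈ AX, ∀ b ∈ AY, T.len o (b * a) = T.len o b + T.len o a := by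
      intro a ha b hb
      obtain ⟨ha, hsa, haX⟩ := hX a ha
      obtain ⟨hb, hsb, hbX⟩ := hY b hb
      exact hred b a hb ha fun h => hbX (hsb ▸ h ▸ haX)
    obtain ⟨m, hm1, hm2⟩ := exists_median AX (T.len o)
    obtain ⟨l, hl1, hl2⟩ := exists_median AY (T.len o)
    rcases le_total m l with hml | hml
    · refine T.exists_axisStab_of_alternating (o := o) (U := AX.filter (fun a => T.len o a ≤ m))
        (B := AY.filter (fun a => l ≤ T.len o a)) ((Finset.filter_subset _ _).trans hAXA)
        ((Finset.filter_subset _ _).trans hAYA) hN hAN hcard (by omega) (by omega) ?_ ?_ ?_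
      · intro u hu b hb
        have h1 := Finset.mem_filter.mp hu
        have h2 := Finset.mem_filter.mp hb
        exact ⟨hpos u (hX u h1.1).1, h1.2.trans (hml.trans h2.2)⟩
      · exact fun u hu b hb => hXY u (Finset.mem_filter.mp hu).1 b (Finset.mem_filter.mp hb).1
      · exact fun u hu b hb => hYX u (Finset.mem_filter.mp hu).1 b (Finset.mem_filter.mp hb).1
    · refine T.exists_axisStab_of_alternating (o := o) (U := AY.filter (fun a => T.len o a ≤ l))
        (B := AX.filter (fun a => m ≤ T.len o a)) ((Finset.filter_subset _ _).trans hAYA)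
        ((Finset.filter_subset _ _).trans hAXA) hN hAN hcard (by omega) (by omega) ?_ ?_ ?_
      · intro u hu b hb
        have h1 := Finset.mem_filter.mp hu
        have h2 := Finset.mem_filter.mp hb
        exact ⟨hpos u (hY u h1.1).1, h1.2.trans (hml.trans h2.2)⟩
      · exact fun u hu b hb => hYX b (Finset.mem_filter.mp hb).1 u (Finset.mem_filter.mp hu).1
      · exact fun u hu b hb => hXY b (Finset.mem_filter.mp hb).1 u (Finset.mem_filter.mp hu).1

end TreeAction

/-! ### Words as the vertices of a rooted tree -/

section PathDist

variable {α : Type*}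

open Classical in
/-- The distance between two words in the rooted tree of all words, in which a word is joined to
its extensions by one letter: the number of letters left after removing the common prefix. -/
noncomputable def pathDist : List α → List α → ℕ
  | [], l => l.length
  | a :: l, [] => (a :: l).length
  | a :: l, b :: l' => if a = b then pathDist l l' else (a :: l).length + (b :: l').length

@[simp] lemma pathDist_nil_left (l : List α) : pathDist [] l = l.length := by simp [pathDist]

@[simp] lemma pathDist_nil_right (l : List α) : pathDist l [] = l.length := by
  cases l <;> simp [pathDist]

@[simp] lemma pathDist_cons_cons (a : α) (l l' : List α) :
    pathDist (a :: l) (a :: l') = pathDist l l' := by simp [pathDist]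

lemma pathDist_cons_of_ne {a b : α} (h : a ≠ b) (l l' : List α) :
    pathDist (a :: l) (b :: l') = l.length + 1 + (l'.length + 1) := by simp [pathDist, h]

lemma pathDist_self (l : List α) : pathDist l l = 0 := by
  induction l <;> simp [*]

lemma pathDist_comm : ∀ l l' : List α, pathDist l l' = pathDist l' l
  | [], l => by simp
  | a :: l, [] => by simp
  | a :: l, b :: l' => by
    by_cases h : a = b
    · subst h; simpa using pathDist_comm l l'
    · rw [pathDist_cons_of_ne h, pathDist_cons_of_ne (Ne.symm h)]; omega

lemma eq_of_pathDist : ∀ {l l' : List α}, pathDist l l' = 0 → l = l'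
  | [], l, h => by simpa [eq_comm] using h
  | a :: l, [], h => by simp at h
  | a :: l, b :: l', h => by
    by_cases hab : a = b
    · subst hab; rw [eq_of_pathDist (l := l) (l' := l') (by simpa using h)]
    · rw [pathDist_cons_of_ne hab] at h; omega

lemma pathDist_le : ∀ l l' : List α, pathDist l l' ≤ l.length + l'.length
  | [], l => by simp
  | a :: l, [] => by simp
  | a :: l, b :: l' => by
    by_cases h : a = b
    · subst h
      have := pathDist_le l l'
      simp only [pathDist_cons_cons, List.length_cons]; omega
    · rw [pathDist_cons_of_ne h]; simp

lemma even_pathDist_add : ∀ l l' : List α, Even (pathDist l l' + l.length + l'.length)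
  | [], l => by simp
  | a :: l, [] => by simp
  | a :: l, b :: l' => by
    by_cases h : a = b
    · subst h
      have := even_pathDist_add l l'
      simp only [pathDist_cons_cons, List.length_cons]
      rw [Nat.even_iff] at this ⊢; omega
    · rw [pathDist_cons_of_ne h, Nat.even_iff]; simp only [List.length_cons]; omega

/-- The lengths of the common prefixes of three words satisfy the ultrametric inequality. -/
lemma length_add_pathDist_le : ∀ x y z : List α,
    x.length + pathDist y z ≤ y.length + pathDist x z ∨
      x.length + pathDist y z ≤ z.length + pathDist x y
  | [], y, z => by left; simpa using pathDist_le y z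
  | _ :: _, [], z => by right; simp [add_comm]
  | _ :: _, y, [] => by left; simp [add_comm]
  | a :: x, b :: y, c :: z => by
    have hle := pathDist_le (b :: y) (c :: z)
    by_cases hab : a = b
    · by_cases hac : a = c
      · subst hab hac
        have := length_add_pathDist_le x y z
        simp only [pathDist_cons_cons, List.length_cons]
        omega
      · left; rw [pathDist_cons_of_ne hac]; simp only [List.length_cons] at hle ⊢; omega
    · right; rw [pathDist_cons_of_ne hab]; simp only [List.length_cons] at hle ⊢; omega

/-- The four point condition follows from the ultrametric inequality for common prefixes. -/
lemma pathDist_four (w x y z : List α) :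
    pathDist w x + pathDist y z ≤ pathDist w y + pathDist x z ∨
      pathDist w x + pathDist y z ≤ pathDist w z + pathDist x y := by
  have a1 := length_add_pathDist_le w x y
  have a2 := length_add_pathDist_le x w y
  have a3 := length_add_pathDist_le y w x
  have b1 := length_add_pathDist_le w x z
  have b2 := length_add_pathDist_le x w z
  have b3 := length_add_pathDist_le z w x
  have c1 := length_add_pathDist_le w y z
  have c2 := length_add_pathDist_le y w z
  have c3 := length_add_pathDist_le z w y
  have e1 := length_add_pathDist_le x y z
  have e2 := length_add_pathDist_le y x z
  have e3 := length_add_pathDist_le z x y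
  simp only [pathDist_comm x w, pathDist_comm y w, pathDist_comm z w, pathDist_comm y x,
    pathDist_comm z x, pathDist_comm z y] at *
  omega

lemma pathDist_even (x y z : List α) :
    Even (pathDist x y + pathDist y z + pathDist z x) := by
  have h1 := even_pathDist_add x y
  have h2 := even_pathDist_add y z
  have h3 := even_pathDist_add z x
  rw [Nat.even_iff] at *
  omega

@[simp] lemma pathDist_append (x l l' : List α) :
    pathDist (x ++ l) (x ++ l') = pathDist l l' := by
  induction x <;> simp [*]

/-- The path from `x` to `y` starts downwards, unless `y` extends `x`. -/
lemma pathDist_dropLast_or : ∀ {x y : List α}, x ≠ y →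
    (x ≠ [] ∧ pathDist x.dropLast y + 1 = pathDist x y) ∨ ∃ c t, y = x ++ c :: t
  | [], [], h => absurd rfl h
  | [], c :: t, _ => .inr ⟨c, t, rfl⟩
  | a :: l, [], _ => by left; simp
  | a :: l, b :: l', h => by
    by_cases hab : a = b
    · subst hab
      rcases pathDist_dropLast_or (x := l) (y := l') (by simpa using h) with ⟨h1, h2⟩ | ⟨c, t, h1⟩
      · left; simpa [List.dropLast_cons_of_ne_nil h1] using h2
      · right; exact ⟨c, t, by simp [h1]⟩
    · left
      refine ⟨by simp, ?_⟩
      rw [pathDist_cons_of_ne hab]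
      rcases l with _ | ⟨d, l⟩
      · simp; omega
      · rw [List.dropLast_cons_of_ne_nil (by simp), pathDist_cons_of_ne hab]
        simp; omega

lemma pathDist_dropLast {x : List α} (h : x ≠ []) : pathDist x x.dropLast = 1 := by
  conv_lhs => rw [← List.dropLast_append_getLast h]
  rw [List.dropLast_concat]
  simpa using pathDist_append x.dropLast [x.getLast h] []

lemma eq_append_of_pathDist_eq_one {x y : List α} (h : pathDist x y = 1) :
    (∃ c, y = x ++ [c]) ∨ ∃ c, x = y ++ [c] := by
  have hne : x ≠ y := by rintro rfl; simp [pathDist_self] at h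
  rcases pathDist_dropLast_or hne with ⟨h1, h2⟩ | ⟨c, t, rfl⟩
  · right
    have := eq_of_pathDist (l := x.dropLast) (l' := y) (by omega)
    exact ⟨x.getLast h1, by rw [← this, List.dropLast_append_getLast]⟩
  · left
    have := pathDist_append x [] (c :: t)
    rw [List.append_nil, h] at this
    simp at this
    exact ⟨c, by simp [this]⟩

end PathDist

/-! ### The Bass–Serre tree of a free product -/

namespace BassSerre

open Monoid.Coprod

variable {G H : Type*} [Group G] [Group H]

/-- The relation between consecutive letters of a word: letters from `G` and `H` alternate, and only
the first letter may be trivial. -/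
def Follows : G ⊕ H → G ⊕ H → Prop
  | .inl _, .inr h => h ≠ 1
  | .inr _, .inl g => g ≠ 1
  | .inl _, .inl _ => False
  | .inr _, .inr _ => False

@[simp] lemma follows_inl_inr (g : G) (h : H) : Follows (.inl g) (.inr h) ↔ h ≠ 1 := Iff.rfl
@[simp] lemma follows_inr_inl (g : G) (h : H) : Follows (.inr h) (.inl g) ↔ g ≠ 1 := Iff.rfl
@[simp] lemma not_follows_inl (g g' : G) :
    ¬ Follows (.inl g : G ⊕ H) (.inl g') := id
@[simp] lemma not_follows_inr (h h' : H) :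
    ¬ Follows (.inr h : G ⊕ H) (.inr h') := id

/-- Words describing the vertices of the Bass–Serre tree of `G * H`, rooted at the coset `G`: the
word `g₁ h₁ g₂ …` stands for the coset of `g₁ h₁ g₂ …` modulo `G` if its length is even and modulo
`H` if its length is odd. The first letter is an element of `G`, possibly trivial. -/
def FromG (l : List (G ⊕ H)) : Prop := l.IsChain Follows ∧ ∀ h, l.head? ≠ some (.inr h)

/-- Words describing the vertices of the Bass–Serre tree of `G * H`, rooted at the coset `H`. -/
def FromH (l : List (G ⊕ H)) : Prop := l.IsChain Follows ∧ ∀ g, l.head? ≠ some (.inl g)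

/-- Left multiplication by an element of `G`, which fixes the vertex `G`. -/
def mulG (g : G) : List (G ⊕ H) → List (G ⊕ H)
  | .inl g' :: l => .inl (g * g') :: l
  | l => l

/-- Left multiplication by an element of `H`, which fixes the vertex `H`. -/
def mulH (h : H) : List (G ⊕ H) → List (G ⊕ H)
  | .inr h' :: l => .inr (h * h') :: l
  | l => l

open Classical in
/-- The change of root from the vertex `G` to the vertex `H`. -/
noncomputable def toH : List (G ⊕ H) → List (G ⊕ H)
  | .inl g :: l => if g = 1 then l else .inr 1 :: .inl g :: l
  | l => .inr 1 :: l

open Classical in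
/-- The change of root from the vertex `H` to the vertex `G`. -/
noncomputable def toG : List (G ⊕ H) → List (G ⊕ H)
  | .inr h :: l => if h = 1 then l else .inl 1 :: .inr h :: l
  | l => .inl 1 :: l

/-- The element of the free product spelled by a word. -/
def eval (l : List (G ⊕ H)) : Monoid.Coprod G H :=
  (l.map (Sum.elim (inl : G →* Monoid.Coprod G H) (inr : H →* Monoid.Coprod G H))).prod

@[simp] lemma eval_nil : eval ([] : List (G ⊕ H)) = 1 := by simp [eval]

@[simp] lemma eval_cons_inl (g : G) (l : List (G ⊕ H)) :
    eval (.inl g :: l) = inl g * eval l := by simp [eval]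

@[simp] lemma eval_cons_inr (h : H) (l : List (G ⊕ H)) :
    eval (.inr h :: l) = inr h * eval l := by simp [eval]

lemma eval_append (l l' : List (G ⊕ H)) : eval (l ++ l') = eval l * eval l' := by simp [eval]

/-- A vertex is the root `G`, or it is the child `H` of the root or below it, or it is another child
of the root or below it. -/
lemma FromG.cases {l : List (G ⊕ H)} (hl : FromG l) :
    l = [] ∨ (∃ t, l = .inl 1 :: t ∧ FromH t) ∨ ∃ g t, g ≠ 1 ∧ l = .inl g :: t ∧ FromH t := by
  rcases l with _ | ⟨g | h, t⟩
  · exact .inl rfl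
  · have ht : FromH t := by
      refine ⟨hl.1.of_cons, fun g' hg' => ?_⟩
      rcases t with _ | ⟨b, t⟩
      · simp at hg'
      · have := hl.1
        simp only [List.head?_cons, Option.some.injEq] at hg'
        subst hg'
        simp at this
    by_cases hg : g = 1
    · subst hg; exact .inr (.inl ⟨t, rfl, ht⟩)
    · exact .inr (.inr ⟨g, t, hg, rfl, ht⟩)
  · exact absurd rfl (hl.2 h)

lemma FromH.cases {l : List (G ⊕ H)} (hl : FromH l) :
    l = [] ∨ (∃ t, l = .inr 1 :: t ∧ FromG t) ∨ ∃ h t, h ≠ 1 ∧ l = .inr h :: t ∧ FromG t := by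
  rcases l with _ | ⟨g | h, t⟩
  · exact .inl rfl
  · exact absurd rfl (hl.2 g)
  · have ht : FromG t := by
      refine ⟨hl.1.of_cons, fun g' hg' => ?_⟩
      rcases t with _ | ⟨b, t⟩
      · simp at hg'
      · have := hl.1
        simp only [List.head?_cons, Option.some.injEq] at hg'
        subst hg'
        simp at this
    by_cases hh : h = 1
    · subst hh; exact .inr (.inl ⟨t, rfl, ht⟩)
    · exact .inr (.inr ⟨h, t, hh, rfl, ht⟩)

/-- After a first letter from `G` a word continues with a nontrivial element of `H`. -/
lemma FromG.tail_cases {g : G} {t : List (G ⊕ H)} (hl : FromG (.inl g :: t)) :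
    t = [] ∨ ∃ h u, h ≠ 1 ∧ t = .inr h :: u := by
  rcases t with _ | ⟨g | h, t⟩
  · exact .inl rfl
  · exact absurd hl.1 (by simp)
  · have := hl.1
    simp only [List.isChain_cons_cons, follows_inl_inr] at this
    exact .inr ⟨h, t, this.1, rfl⟩

lemma FromH.tail_cases {h : H} {t : List (G ⊕ H)} (hl : FromH (.inr h :: t)) :
    t = [] ∨ ∃ g u, g ≠ 1 ∧ t = .inl g :: u := by
  rcases t with _ | ⟨g | h, t⟩
  · exact .inl rfl
  · have := hl.1
    simp only [List.isChain_cons_cons, follows_inr_inl] at this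
    exact .inr ⟨g, t, this.1, rfl⟩
  · exact absurd hl.1 (by simp)

lemma FromG.mulG {l : List (G ⊕ H)} (hl : FromG l) (g : G) : FromG (mulG g l) := by
  rcases l with _ | ⟨g' | h, t⟩
  · exact hl
  · refine ⟨?_, by simp [BassSerre.mulG]⟩
    rcases hl.tail_cases with rfl | ⟨h, u, hh, rfl⟩
    · simp [BassSerre.mulG]
    · simpa [BassSerre.mulG] using hl.1
  · exact hl

lemma FromH.mulH {l : List (G ⊕ H)} (hl : FromH l) (h : H) : FromH (mulH h l) := by
  rcases l with _ | ⟨g' | h', t⟩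
  · exact hl
  · exact hl
  · refine ⟨?_, by simp [BassSerre.mulH]⟩
    rcases hl.tail_cases with rfl | ⟨h, u, hh, rfl⟩
    · simp [BassSerre.mulH]
    · simpa [BassSerre.mulH] using hl.1

lemma FromG.toH {l : List (G ⊕ H)} (hl : FromG l) : FromH (toH l) := by
  rcases hl.cases with rfl | ⟨t, rfl, ht⟩ | ⟨g, t, hg, rfl, ht⟩
  · simp [BassSerre.toH, FromH]
  · simpa [BassSerre.toH] using ht
  · simpa [BassSerre.toH, hg, FromH] using hl.1

lemma FromH.toG {l : List (G ⊕ H)} (hl : FromH l) : FromG (toG l) := by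
  rcases hl.cases with rfl | ⟨t, rfl, ht⟩ | ⟨g, t, hg, rfl, ht⟩
  · simp [BassSerre.toG, FromG]
  · simpa [BassSerre.toG] using ht
  · simpa [BassSerre.toG, hg, FromG] using hl.1

lemma FromG.toG_toH {l : List (G ⊕ H)} (hl : FromG l) : BassSerre.toG (BassSerre.toH l) = l := by
  rcases hl.cases with rfl | ⟨t, rfl, ht⟩ | ⟨g, t, hg, rfl, ht⟩
  · simp [BassSerre.toG, BassSerre.toH]
  · rcases hl.tail_cases with rfl | ⟨h, u, hh, rfl⟩
    · simp [BassSerre.toG, BassSerre.toH]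
    · simp [BassSerre.toG, BassSerre.toH, hh]
  · simp [BassSerre.toG, BassSerre.toH, hg]

lemma FromH.toH_toG {l : List (G ⊕ H)} (hl : FromH l) : BassSerre.toH (BassSerre.toG l) = l := by
  rcases hl.cases with rfl | ⟨t, rfl, ht⟩ | ⟨g, t, hg, rfl, ht⟩
  · simp [BassSerre.toG, BassSerre.toH]
  · rcases hl.tail_cases with rfl | ⟨h, u, hh, rfl⟩
    · simp [BassSerre.toG, BassSerre.toH]
    · simp [BassSerre.toG, BassSerre.toH, hh]
  · simp [BassSerre.toG, BassSerre.toH, hg]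

lemma mulG_one {G H : Type*} [Group G] (l : List (G ⊕ H)) : mulG 1 l = l := by
  rcases l with _ | ⟨g | h, t⟩ <;> simp [mulG]

lemma mulH_one {G H : Type*} [Group H] (l : List (G ⊕ H)) : mulH 1 l = l := by
  rcases l with _ | ⟨g | h, t⟩ <;> simp [mulH]

lemma mulG_mul {G H : Type*} [Group G] (g g' : G) (l : List (G ⊕ H)) :
    mulG (g * g') l = mulG g (mulG g' l) := by
  rcases l with _ | ⟨g | h, t⟩ <;> simp [mulG, mul_assoc]

lemma mulH_mul {G H : Type*} [Group H] (h h' : H) (l : List (G ⊕ H)) :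
    mulH (h * h') l = mulH h (mulH h' l) := by
  rcases l with _ | ⟨g | h, t⟩ <;> simp [mulH, mul_assoc]

@[simp] lemma length_mulG {G H : Type*} [Group G] (g : G) (l : List (G ⊕ H)) :
    (mulG g l).length = l.length := by
  rcases l with _ | ⟨g | h, t⟩ <;> simp [mulG]

@[simp] lemma length_mulH {G H : Type*} [Group H] (h : H) (l : List (G ⊕ H)) :
    (mulH h l).length = l.length := by
  rcases l with _ | ⟨g | h, t⟩ <;> simp [mulH]

lemma even_length_toH (l : List (G ⊕ H)) : Even ((toH l).length + l.length + 1) := by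
  rcases l with _ | ⟨g | h, t⟩
  · simp [toH]
  · by_cases hg : g = 1 <;> simp [toH, hg, parity_simps]
  · simp [toH, parity_simps]

lemma even_length_toG (l : List (G ⊕ H)) : Even ((toG l).length + l.length + 1) := by
  rcases l with _ | ⟨g | h, t⟩
  · simp [toG]
  · simp [toG, parity_simps]
  · by_cases hh : h = 1 <;> simp [toG, hh, parity_simps]

lemma eval_toH (l : List (G ⊕ H)) : eval (toH l) = eval l := by
  rcases l with _ | ⟨g | h, t⟩
  · simp [toH]
  · by_cases hg : g = 1 <;> simp [toH, hg]
  · simp [toH]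

lemma eval_toG (l : List (G ⊕ H)) : eval (toG l) = eval l := by
  rcases l with _ | ⟨g | h, t⟩
  · simp [toG]
  · simp [toG]
  · by_cases hh : h = 1 <;> simp [toG, hh]

lemma pathDist_mulG {G H : Type*} [Group G] (g : G) (x y : List (G ⊕ H)) :
    pathDist (mulG g x) (mulG g y) = pathDist x y := by
  rcases x with _ | ⟨a | a, x⟩ <;> rcases y with _ | ⟨b | b, y⟩ <;> try simp [mulG, pathDist]
  by_cases hab : a = b
  · simp [hab]
  · rw [if_neg (by simpa using hab), if_neg (by simpa using hab)]

lemma pathDist_mulH {G H : Type*} [Group H] (h : H) (x y : List (G ⊕ H)) :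
    pathDist (mulH h x) (mulH h y) = pathDist x y := by
  rcases x with _ | ⟨a | a, x⟩ <;> rcases y with _ | ⟨b | b, y⟩ <;> try simp [mulH, pathDist]
  by_cases hab : a = b
  · simp [hab]
  · rw [if_neg (by simpa using hab), if_neg (by simpa using hab)]

/-- A vertex on the side of `G` and a vertex on the side of `H` of the edge between `G` and `H`
have the same distance with respect to both roots. -/
lemma pathDist_toH_aux {x t : List (G ⊕ H)} (hx : x = [] ∨ ∃ g u, g ≠ 1 ∧ x = .inl g :: u)
    (ht : FromG (.inl 1 :: t)) : pathDist (.inr 1 :: x) t = pathDist x (.inl 1 :: t) := by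
  have h1 : pathDist (.inr 1 :: x) t = x.length + 1 + t.length := by
    rcases ht.tail_cases with rfl | ⟨h, u, hh, rfl⟩
    · simp
    · rw [pathDist_cons_of_ne (by simpa using hh.symm)]; simp
  rw [h1]
  rcases hx with rfl | ⟨g, u, hg, rfl⟩
  · simp [add_comm]
  · rw [pathDist_cons_of_ne (by simpa using hg)]; simp; omega

lemma pathDist_toH {x y : List (G ⊕ H)} (hx : FromG x) (hy : FromG y) :
    pathDist (toH x) (toH y) = pathDist x y := by
  have key : ∀ {z : List (G ⊕ H)}, FromG z →
      (∃ t, z = .inl 1 :: t ∧ toH z = t) ∨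
      (toH z = .inr 1 :: z ∧ (z = [] ∨ ∃ g u, g ≠ 1 ∧ z = .inl g :: u)) := by
    intro z hz
    rcases hz.cases with rfl | ⟨t, rfl, -⟩ | ⟨g, t, hg, rfl, -⟩
    · right; simp [toH]
    · left; exact ⟨t, rfl, by simp [toH]⟩
    · right; exact ⟨by simp [toH, hg], .inr ⟨g, t, hg, rfl⟩⟩
  rcases key hx with ⟨t, rfl, ht⟩ | ⟨h1, h2⟩ <;> rcases key hy with ⟨t', rfl, ht'⟩ | ⟨h3, h4⟩
  · rw [ht, ht']; simp
  · rw [ht, h3, pathDist_comm, pathDist_toH_aux h4 hx, pathDist_comm]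
  · rw [h1, ht', pathDist_toH_aux h2 hy]
  · rw [h1, h3]; simp

lemma pathDist_toG {x y : List (G ⊕ H)} (hx : FromH x) (hy : FromH y) :
    pathDist (toG x) (toG y) = pathDist x y := by
  rw [← pathDist_toH hx.toG hy.toG, hx.toH_toG, hy.toH_toG]

variable (G H) in
/-- The vertices of the Bass–Serre tree of `G * H`, as words rooted at the vertex `G`. -/
@[ext] structure Vertex where
  /-- The word describing the vertex. -/
  word : List (G ⊕ H)
  fromG : FromG word

variable (G H) in
/-- The action of `G * H` on its Bass–Serre tree: `G` changes the first letter of the words rooted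
at the vertex `G`, and `H` changes the first letter of the words rooted at the vertex `H`. -/
noncomputable def actionHom : Monoid.Coprod G H →* Function.End (Vertex G H) :=
  Monoid.Coprod.lift
    { toFun := fun g v => ⟨mulG g v.1, v.2.mulG g⟩
      map_one' := funext fun v => Vertex.ext (mulG_one v.1)
      map_mul' := fun g g' => funext fun v => Vertex.ext (mulG_mul g g' v.1) }
    { toFun := fun h v => ⟨toG (mulH h (toH v.1)), (v.2.toH.mulH h).toG⟩
      map_one' := funext fun v => Vertex.ext (by
        change toG (mulH 1 (toH v.word)) = v.word
        rw [mulH_one, v.2.toG_toH])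
      map_mul' := fun h h' => funext fun v => Vertex.ext (by
        change toG (mulH (h * h') (toH v.1)) = toG (mulH h (toH (toG (mulH h' (toH v.1)))))
        rw [(v.2.toH.mulH h').toH_toG, mulH_mul]) }

noncomputable instance : MulAction (Monoid.Coprod G H) (Vertex G H) :=
  MulAction.ofEndHom (actionHom G H)

instance : Nonempty (Vertex G H) := ⟨⟨[], by simp [FromG]⟩⟩

lemma inl_smul (g : G) (v : Vertex G H) :
    ((inl g : Monoid.Coprod G H) • v).1 = mulG g v.1 := rfl

lemma inr_smul (h : H) (v : Vertex G H) :
    ((inr h : Monoid.Coprod G H) • v).1 = toG (mulH h (toH v.1)) := rfl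

lemma pathDist_smul (x : Monoid.Coprod G H) (v w : Vertex G H) :
    pathDist (x • v).1 (x • w).1 = pathDist v.1 w.1 := by
  induction x using Monoid.Coprod.induction_on generalizing v w with
  | inl g => rw [inl_smul, inl_smul, pathDist_mulG]
  | inr h =>
    rw [inr_smul, inr_smul, pathDist_toG (v.2.toH.mulH h) (w.2.toH.mulH h), pathDist_mulH,
      pathDist_toH v.2 w.2]
  | mul x y hx hy => rw [mul_smul, mul_smul, hx, hy]

lemma even_length_smul (x : Monoid.Coprod G H) (v : Vertex G H) :
    Even ((x • v).1.length + v.1.length) := by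
  induction x using Monoid.Coprod.induction_on generalizing v with
  | inl g => rw [inl_smul, length_mulG]; exact ⟨_, rfl⟩
  | inr h =>
    have h1 := even_length_toG (mulH h (toH v.1))
    have h2 := even_length_toH v.1
    rw [length_mulH] at h1
    rw [inr_smul]
    rw [Nat.even_iff] at *
    omega
  | mul x y hx hy =>
    have h1 := hx (y • v)
    have h2 := hy v
    rw [mul_smul]
    rw [Nat.even_iff] at *
    omega

variable (G H) in
/-- The factor whose cosets are the vertices at distance `n` from the root. -/
noncomputable def factor (n : ℕ) : Subgroup (Monoid.Coprod G H) :=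
  if Even n then (inl : G →* Monoid.Coprod G H).range else (inr : H →* Monoid.Coprod G H).range

lemma factor_congr {m n : ℕ} (h : Even (m + n)) : factor G H m = factor G H n := by
  rw [Nat.even_add] at h
  simp [factor, h]

/-- The action on words is the left multiplication of cosets. -/
lemma eval_smul_mem (x : Monoid.Coprod G H) (v : Vertex G H) :
    (eval (x • v).1)⁻¹ * x * eval v.1 ∈ factor G H v.1.length := by
  induction x using Monoid.Coprod.induction_on generalizing v with
  | inl g =>
    rw [inl_smul]
    rcases v.2.cases with hv | ⟨t, hv, -⟩ | ⟨g', t, -, hv, -⟩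
    · rw [hv]; simp [mulG, factor]
    · rw [hv]; simp [mulG, mul_assoc, one_mem]
    · rw [hv]; simp [mulG, mul_assoc, one_mem]
  | inr h =>
    rw [inr_smul, eval_toG, ← eval_toH v.1]
    have hlen := even_length_toH v.1
    rcases v.2.toH.cases with hv | ⟨t, hv, -⟩ | ⟨g', t, -, hv, -⟩
    · rw [hv] at hlen ⊢
      have : ¬ Even v.1.length := by
        rw [Nat.even_iff] at *; simp at hlen; omega
      simp [mulH, factor, this]
    · rw [hv]; simp [mulH, mul_assoc, one_mem]
    · rw [hv]; simp [mulH, mul_assoc, one_mem]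
  | mul x y hx hy =>
    have h1 := hx (y • v)
    rw [factor_congr (even_length_smul y v)] at h1
    have h2 := mul_mem h1 (hy v)
    rw [mul_smul]
    convert h2 using 1
    group

lemma eval_inv_mul_mul_mem {x : Monoid.Coprod G H} {v : Vertex G H} (h : x • v = v) :
    (eval v.1)⁻¹ * x * eval v.1 ∈ factor G H v.1.length := by
  simpa [h] using eval_smul_mem x v

lemma eq_one_of_mem_ranges {x : Monoid.Coprod G H}
    (h1 : x ∈ (inl : G →* Monoid.Coprod G H).range)
    (h2 : x ∈ (inr : H →* Monoid.Coprod G H).range) : x = 1 := by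
  obtain ⟨g, rfl⟩ := h1
  obtain ⟨h, hh⟩ := h2
  have := congrArg (fst : Monoid.Coprod G H →* G) hh
  simp at this
  simp [← this]

/-- Edge stabilisers are trivial. -/
lemma eq_one_of_smul_eq_of_append {x : Monoid.Coprod G H} {v w : Vertex G H} {c : G ⊕ H}
    (hw : w.1 = v.1 ++ [c]) (h1 : x • v = v) (h2 : x • w = w) : x = 1 := by
  have m1 := eval_inv_mul_mul_mem h1
  have m2 := eval_inv_mul_mul_mem h2
  rw [hw, eval_append] at m2
  set q := (eval v.1)⁻¹ * x * eval v.1 with hq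
  have hx : q = 1 → x = 1 := fun h => by
    rw [hq] at h
    simpa using conj_eq_one_iff.1 (show (eval v.1)⁻¹ * x * ((eval v.1)⁻¹)⁻¹ = 1 by simpa using h)
  have m3 : (eval [c])⁻¹ * q * eval [c] ∈ factor G H (v.1.length + 1) := by
    have e : (eval [c])⁻¹ * q * eval [c] = (eval v.1 * eval [c])⁻¹ * x * (eval v.1 * eval [c]) := by
      rw [hq]; group
    rw [e]
    simpa using m2
  have hback : (eval [c])⁻¹ * q * eval [c] = 1 → q = 1 := fun h => by
    simpa using conj_eq_one_iff.1 (show (eval [c])⁻¹ * q * ((eval [c])⁻¹)⁻¹ = 1 by simpa using h)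
  -- `q` and its conjugate by `c` lie in different factors. As `c` belongs to one of the factors,
  -- one of the two elements lies in both.
  have hconj : ∀ K : Subgroup (Monoid.Coprod G H), eval [c] ∈ K →
      (q ∈ K ↔ (eval [c])⁻¹ * q * eval [c] ∈ K) := fun K hc => by
    constructor
    · exact fun hqK => mul_mem (mul_mem (inv_mem hc) hqK) hc
    · intro hqK
      have := mul_mem (mul_mem hc hqK) (inv_mem hc)
      convert this using 1
      group
  by_cases hn : Even v.1.length
  · rw [factor, if_pos hn] at m1
    rw [factor, if_neg (by simpa [Nat.even_add_one] using hn)] at m3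
    rcases c with g | h
    · exact hx (hback (eq_one_of_mem_ranges ((hconj (inl : G →* _).range ⟨g, by simp⟩).1 m1) m3))
    · exact hx (eq_one_of_mem_ranges m1 ((hconj (inr : H →* _).range ⟨h, by simp⟩).2 m3))
  · rw [factor, if_neg hn] at m1
    rw [factor, if_pos (by simpa [Nat.even_add_one] using hn)] at m3
    rcases c with g | h
    · exact hx (eq_one_of_mem_ranges ((hconj (inl : G →* _).range ⟨g, by simp⟩).2 m3) m1)
    · exact hx (hback (eq_one_of_mem_ranges m3 ((hconj (inr : H →* _).range ⟨h, by simp⟩).1 m1)))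

/-- The next vertex on the way from `v` to `w`. -/
lemma exists_step {v w : Vertex G H} (h : v ≠ w) :
    ∃ z : Vertex G H, pathDist v.1 z.1 = 1 ∧ pathDist z.1 w.1 + 1 = pathDist v.1 w.1 := by
  rcases pathDist_dropLast_or (fun hvw => h (Vertex.ext hvw)) with ⟨h1, h2⟩ | ⟨c, t, h1⟩
  · refine ⟨⟨v.1.dropLast, v.2.1.prefix (List.dropLast_prefix _), fun a ha => ?_⟩,
      pathDist_dropLast h1, h2⟩
    obtain ⟨s, hs⟩ := List.head?_eq_some_iff.1 ha
    obtain ⟨u, hu⟩ := List.dropLast_prefix v.1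
    exact v.2.2 a (by rw [← hu, hs]; simp)
  · have hpre : v.1 ++ [c] <+: w.1 := ⟨t, by rw [h1]; simp⟩
    refine ⟨⟨v.1 ++ [c], w.2.1.prefix hpre, fun a ha => ?_⟩, ?_, ?_⟩
    · obtain ⟨s, hs⟩ := List.head?_eq_some_iff.1 ha
      obtain ⟨u, hu⟩ := hpre
      exact w.2.2 a (by rw [← hu, hs]; simp)
    · simpa using pathDist_append v.1 [] [c]
    · have e1 := pathDist_append (v.1 ++ [c]) [] t
      have e2 := pathDist_append v.1 [] (c :: t)
      simp only [List.append_nil, List.append_assoc, List.singleton_append] at e1 e2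
      simp only [h1, e1, e2]
      simp

lemma eq_one_of_smul_eq {x : Monoid.Coprod G H} {v w : Vertex G H}
    (hv : x • v = v) (hw : x • w = w) (h : v ≠ w) : x = 1 := by
  obtain ⟨z, h1, h2⟩ := exists_step h
  -- The next vertex is unique, hence fixed.
  have hz : x • z = z := by
    have e1 : pathDist v.1 (x • z).1 = 1 := by rw [← h1, ← pathDist_smul x v z, hv]
    have e2 : pathDist (x • z).1 w.1 = pathDist z.1 w.1 := by rw [← pathDist_smul x z w, hw]
    have e3 := pathDist_four v.1 w.1 z.1 (x • z).1
    rw [pathDist_comm w.1 (x • z).1, pathDist_comm w.1 z.1] at e3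
    exact (Vertex.ext (eq_of_pathDist (by omega))).symm
  rcases eq_append_of_pathDist_eq_one h1 with ⟨c, hc⟩ | ⟨c, hc⟩
  · exact eq_one_of_smul_eq_of_append hc hv hz
  · exact eq_one_of_smul_eq_of_append hc hz hv

variable (G H) in
/-- The action of a free product on its Bass–Serre tree. -/
noncomputable def treeAction : TreeAction (Monoid.Coprod G H) (Vertex G H) where
  d v w := pathDist v.1 w.1
  eq_of_d h := Vertex.ext (eq_of_pathDist h)
  d_self v := pathDist_self v.1
  comm v w := pathDist_comm v.1 w.1
  four w x y z := pathDist_four w.1 x.1 y.1 z.1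
  even x y z := pathDist_even x.1 y.1 z.1
  step := exists_step
  smul := pathDist_smul
  even_smul x v := by
    have h1 := even_pathDist_add v.1 (x • v).1
    have h2 := even_length_smul x v
    rw [Nat.even_iff] at *
    omega
  free _ _ _ := eq_one_of_smul_eq

/-- A set which fixes a vertex is conjugate into one of the factors. -/
lemma isConjugateInto_of_smul_eq {A : Set (Monoid.Coprod G H)} {v : Vertex G H}
    (h : ∀ x ∈ A, x • v = v) :
    IsConjugateInto A (inl : G →* Monoid.Coprod G H).range ∨
      IsConjugateInto A (inr : H →* Monoid.Coprod G H).range := by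
  have key : IsConjugateInto A (factor G H v.1.length) := by
    refine ⟨(eval v.1)⁻¹, ?_⟩
    rintro _ ⟨x, hx, rfl⟩
    simpa using eval_inv_mul_mul_mem (h x hx)
  by_cases hn : Even v.1.length
  · left; rwa [factor, if_pos hn] at key
  · right; rwa [factor, if_neg hn] at key

end BassSerre

/-! ### Finite subsets of free products -/

theorem corollary2p12 {G : Type*} {H : Type*} [Group G] [Group H]
    (A : Set (Monoid.Coprod G H)) (hA : A.Finite) :
    (IsConjugateInto A (Monoid.Coprod.inl : G →* Monoid.Coprod G H).range ∨
      IsConjugateInto A (Monoid.Coprod.inr : H →* Monoid.Coprod G H).range) ∨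
    (1 / 7776 : ℝ) * (A.ncard : ℝ) ^ 2 ≤ ((A ^ 3).ncard : ℝ) ∨
    (IsInfiniteCyclic (Subgroup.closure A) ∨ IsInfiniteDihedral (Subgroup.closure A)) := by
  classical
  by_cases hN : A.ncard ^ 2 ≤ 7776 * (A ^ 3).ncard
  · right; left
    have h : (A.ncard : ℝ) ^ 2 ≤ 7776 * ((A ^ 3).ncard : ℝ) := by exact_mod_cast hN
    linarith
  push Not at hN
  lift A to Finset (Monoid.Coprod G H) using hA
  rw [← Finset.coe_pow, Set.ncard_coe_finset, Set.ncard_coe_finset] at hN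
  -- A product set is at least as large as each of its factors.
  have hAN : A.card ≤ (A ^ 3).card := Finset.card_le_card_pow (by norm_num)
  have himage : ∀ c ∈ A, ((A ×ˢ A).image (fun p => p.1 * c * p.2)).card ≤ (A ^ 3).card := by
    refine fun c hc => Finset.card_le_card (Finset.image_subset_iff.2 fun p hp => ?_)
    rw [Finset.mem_product] at hp
    rw [pow_succ, pow_two]
    exact Finset.mul_mem_mul (Finset.mul_mem_mul hp.1 hc) hp.2
  rcases (BassSerre.treeAction G H).exists_fixed_or_exists_axisStab himage hAN hN with
    ⟨v, hv⟩ | ⟨t, ht, hAt⟩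
  · exact .inl (BassSerre.isConjugateInto_of_smul_eq hv)
  · right; right
    exact ht.isInfiniteCyclic_or_isInfiniteDihedral ((Subgroup.closure_le _).2 hAt)
      (S := A) (fun v hv => Subgroup.subset_closure hv) (by nlinarith)
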